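/- Terms are considered up to $\alpha$-equivalence over a fixed countably infinite set $\mathcal V$ of variables. Let $\Lambda^{001}_\infty=\nu Y.\mu X.(\mathcal V+\lambda\mathcal V.X+(X)Y)$ be the set of 001-infinitary $\lambda$-terms, i.e. the possibly infinite $\lambda$-terms all of whose infinite branches enter the argument of an application infinitely often. Let $\to_\beta$ be the contextual closure of $(\lambda x.M)N\to M[N/x]$ on $\Lambda^{001}_\infty$, $\to_\beta^*$ its reflexive-transitive closure, and let $\to_\beta^\infty$ be the 001-strongly convergent closure, defined by the following rules, which are read inductively except that the premise marked $\triangleright$ is read coinductively: if $M\to_\beta^* x$ then $M\to_\beta^\infty x$; if $M\to_\beta^*\lambda x.P$ and $P\to_\beta^\infty P'$ then $M\to_\beta^\infty\lambda x.P'$; if $M\to_\beta^*(P)Q$, $P\to_\beta^\infty P'$ and $\triangleright\, Q\to_\beta^\infty Q'$ then $M\to_\beta^\infty(P')Q'$. Resource terms are given inductively by $s::=x\mid\lambda x.s\mid\langle s\rangle\bar t$, where $\bar t$ ranges over finite multisets of resource terms. Finite sums of resource terms (or of multisets) are finite sets of them (Boolean coefficients), the empty set being $0$, and the constructors extend to sums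 by linearity. For $\bar t=[t_1,\dots,t_n]$, the sum $s\langle\bar t/x\rangle$ is $\sum_{\sigma\in\mathfrak S_n}s[t_{\sigma(1)}/x_1,\dots,t_{\sigma(n)}/x_n]$ if $x$ has exactly $n$ free occurrences $x_1,\dots,x_n$ in $s$, and $0$ otherwise. Let $\mapsto_r$ be the contextual closure of $\langle\lambda x.s\rangle\bar t\mapsto_r s\langle\bar t/x\rangle$ (reducing in one place, possibly in one element of a multiset), and on finite sums let $\sum_{i=0}^n s_i\to_r\sum_{i=0}^n T_i$ whenever $s_0\mapsto_r T_0$ and, for $1\le i\le n$, $s_i\mapsto_r T_i$ or $T_i=s_i$. Let $\mathrm{nf}_r(s)$ be the normal form of $s$ under $\to_r$. A resource term is $0$-positive always; for $d\ge1$, every variable is $d$-positive, $\lambda x.s$ is $d$-positive iff $s$ is, and $\langle s\rangle\bar t$ is $d$-positive iff $s$ is $d$-positive, $\bar t$ is non-empty and every element of $\bar t$ is $(d-1)$-positive. The Taylor approximation $s\ltimes M$ is defined inductively by: $x\ltimes x$; $\lambda x.s\ltimes\lambda x.M$ if $s\ltimes M$; $\langle s\rangle[t_1,\dots,t_n]\ltimes(M)N$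 if $s\ltimes M$ and $t_i\ltimes N$ for all $i$ ($n\ge0$). Put $\mathcal T(M)=\{s : s\ltimes M\}$. \textbf{Corollary (characterisation of normalisable terms).} Let $M\in\Lambda^{001}_\infty$. The following are equivalent: (1) there exists $N\in\Lambda^{001}_\infty$ in $\beta$-normal form (no $N'$ with $N\to_\beta N'$) such that $M\to_\beta^\infty N$; (2) for every $d\in\mathbb N$ there exists $s\in\mathcal T(M)$ such that $\mathrm{nf}_r(s)$ contains a $d$-positive term. -/

import Mathlib

/-! ## Infinitary λ-terms

Terms are taken up to α-equivalence: `λ` binds the de Bruijn index `0` of its body, and an index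
that is not bound by an enclosing `λ` is a free variable.  The type `InfTerm` of all (finite or
infinite) terms is the terminal coalgebra of `X ↦ 𝒱 + λ.X + (X)X`. -/

/-- Node labels of λ-terms. -/
inductive InfLabel : Type
  | var (n : ℕ)
  | lam
  | app

/-- The signature of λ-terms as a polynomial functor. The two children of an application are
indexed by `false` (function position) and `true` (argument position). -/
def infSig : PFunctor.{0, 0} where
  A := InfLabel
  B := fun a => match a with
    | .var _ => Empty
    | .lam => Unit
    | .app => Bool

/-- All infinitary λ-terms, coinductively built on the signature. -/
abbrev InfTerm : Type := PFunctor.M infSig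

/-- Lifting a renaming of de Bruijn indices under one binder. -/
def upRen (ρ : ℕ → ℕ) : ℕ → ℕ
  | 0 => 0
  | n + 1 => ρ n + 1

namespace InfTerm

/-- A one-layer term whose root is a variable. -/
def varNode {X : Type} (n : ℕ) : infSig X := ⟨InfLabel.var n, fun e : Empty => e.elim⟩

/-- A one-layer term whose root is an abstraction. -/
def lamNode {X : Type} (x : X) : infSig X := ⟨InfLabel.lam, fun _ : Unit => x⟩

/-- A one-layer term whose root is an application. -/
def appNode {X : Type} (x y : X) : infSig X :=
  ⟨InfLabel.app, fun b : Bool => match b with | false => x | true => y⟩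

/-- The variable with index `n`. -/
def var (n : ℕ) : InfTerm := PFunctor.M.mk (varNode n)

/-- The abstraction `λ.M`. -/
def lam (M : InfTerm) : InfTerm := PFunctor.M.mk (lamNode M)

/-- The application `(M)N`. -/
def app (M N : InfTerm) : InfTerm := PFunctor.M.mk (appNode M N)

/-- Case analysis on the root of a one-layer term. -/
def caseNode {X Y : Type} (fvar : ℕ → Y) (flam : X → Y) (fapp : X → X → Y) : infSig X → Y
  | ⟨.var n, _⟩ => fvar n
  | ⟨.lam, f⟩ => flam (f ())
  | ⟨.app, f⟩ => fapp (f false) (f true)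

/-- Renaming of free variables, by corecursion. -/
def rename (ρ : ℕ → ℕ) (M : InfTerm) : InfTerm :=
  PFunctor.M.corec
    (fun p : (ℕ → ℕ) × InfTerm =>
      caseNode (fun n => varNode (p.1 n)) (fun P => lamNode (upRen p.1, P))
        (fun P Q => appNode (p.1, P) (p.1, Q)) (PFunctor.M.dest p.2))
    (ρ, M)

/-- One step of the corecursion that defines substitution: in state `Sum.inl (k, M)` the term `M`
is being substituted into below `k` binders, in state `Sum.inr T` the term `T` is being copied. -/
def substStep (N : InfTerm) : (ℕ × InfTerm) ⊕ InfTerm → infSig ((ℕ × InfTerm) ⊕ InfTerm)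
  | Sum.inr T => infSig.map Sum.inr (PFunctor.M.dest T)
  | Sum.inl (k, M) =>
      caseNode
        (fun n =>
          if n < k then varNode n
          else if n = k then infSig.map Sum.inr (PFunctor.M.dest (rename (fun i => i + k) N))
          else varNode (n - 1))
        (fun P => lamNode (Sum.inl (k + 1, P)))
        (fun P Q => appNode (Sum.inl (k, P)) (Sum.inl (k, Q)))
        (PFunctor.M.dest M)

/-- `substAt k N M` removes the variable of index `k` from `M` and puts `N` in its place; here `M`
lies below `k` further binders, above which `N` lives. In particular `substAt 0 N M` is the
contractum of `(λ.M)N`. -/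
def substAt (k : ℕ) (N M : InfTerm) : InfTerm :=
  PFunctor.M.corec (substStep N) (Sum.inl (k, M))

/-! The defining equations of renaming and substitution. -/

theorem cases_term (M : InfTerm) :
    (∃ n, M = var n) ∨ (∃ P, M = lam P) ∨ ∃ P Q, M = app P Q := by
  rw [← PFunctor.M.mk_dest M]
  rcases PFunctor.M.dest M with ⟨a, f⟩
  cases a with
  | var n =>
    refine Or.inl ⟨n, congrArg PFunctor.M.mk ?_⟩
    exact Sigma.ext rfl (heq_of_eq (funext fun e : Empty => e.elim))
  | lam => exact Or.inr (Or.inl ⟨f (), rfl⟩)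
  | app =>
    refine Or.inr (Or.inr ⟨f false, f true, congrArg PFunctor.M.mk ?_⟩)
    exact Sigma.ext rfl (heq_of_eq (funext fun b : Bool => by cases b <;> rfl))

theorem map_varNode {X Y : Type} (g : X → Y) (n : ℕ) :
    infSig.map g (varNode n) = varNode n :=
  Sigma.ext rfl (heq_of_eq (funext fun e : Empty => e.elim))

theorem map_lamNode {X Y : Type} (g : X → Y) (x : X) :
    infSig.map g (lamNode x) = lamNode (g x) := rfl

theorem map_appNode {X Y : Type} (g : X → Y) (x y : X) :
    infSig.map g (appNode x y) = appNode (g x) (g y) :=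
  Sigma.ext rfl (heq_of_eq (funext fun b : Bool => by cases b <;> rfl))

theorem rename_var (ρ : ℕ → ℕ) (n : ℕ) : rename ρ (var n) = var (ρ n) := by
  rw [rename, PFunctor.M.corec_def]
  exact congrArg PFunctor.M.mk (map_varNode _ _)

theorem rename_lam (ρ : ℕ → ℕ) (M : InfTerm) :
    rename ρ (lam M) = lam (rename (upRen ρ) M) := by
  rw [rename, PFunctor.M.corec_def]
  exact congrArg PFunctor.M.mk (map_lamNode _ _)

theorem rename_app (ρ : ℕ → ℕ) (M N : InfTerm) :
    rename ρ (app M N) = app (rename ρ M) (rename ρ N) := by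
  rw [rename, PFunctor.M.corec_def]
  exact congrArg PFunctor.M.mk (map_appNode _ _ _)

theorem corec_copy (N T : InfTerm) : PFunctor.M.corec (substStep N) (Sum.inr T) = T := by
  have h : ∀ T : InfTerm, PFunctor.M.dest (PFunctor.M.corec (substStep N) (Sum.inr T)) =
      infSig.map (fun T => PFunctor.M.corec (substStep N) (Sum.inr T)) (PFunctor.M.dest T) := by
    intro T
    rw [PFunctor.M.dest_corec]
    rfl
  have h1 := PFunctor.M.corec_unique PFunctor.M.dest
    (fun T => PFunctor.M.corec (substStep N) (Sum.inr T)) h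
  have h2 := PFunctor.M.corec_unique (P := infSig) PFunctor.M.dest (fun T : InfTerm => T)
    (fun T => (infSig.id_map _).symm)
  exact congrFun (h1.trans h2.symm) T

theorem substAt_var_lt (N : InfTerm) {k n : ℕ} (h : n < k) : substAt k N (var n) = var n := by
  rw [substAt, PFunctor.M.corec_def]
  refine congrArg PFunctor.M.mk (Eq.trans (congrArg _ ?_) (map_varNode _ n))
  exact if_pos h

theorem substAt_var_eq (N : InfTerm) (k : ℕ) :
    substAt k N (var k) = rename (fun i => i + k) N := by
  rw [substAt, PFunctor.M.corec_def]
  have h : substStep N (Sum.inl (k, var k)) =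
      infSig.map Sum.inr (PFunctor.M.dest (rename (fun i => i + k) N)) :=
    (if_neg (lt_irrefl k)).trans (if_pos rfl)
  rw [h, PFunctor.map_map]
  have h2 : PFunctor.M.corec (substStep N) ∘ Sum.inr = id := funext (corec_copy N)
  rw [h2, PFunctor.id_map, PFunctor.M.mk_dest]

theorem substAt_var_gt (N : InfTerm) {k n : ℕ} (h : k < n) :
    substAt k N (var n) = var (n - 1) := by
  rw [substAt, PFunctor.M.corec_def]
  refine congrArg PFunctor.M.mk (Eq.trans (congrArg _ ?_) (map_varNode _ (n - 1)))
  exact (if_neg (by omega)).trans (if_neg (by omega))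

theorem substAt_lam (k : ℕ) (N M : InfTerm) :
    substAt k N (lam M) = lam (substAt (k + 1) N M) := by
  rw [substAt, PFunctor.M.corec_def]
  exact congrArg PFunctor.M.mk (map_lamNode _ _)

theorem substAt_app (k : ℕ) (N P Q : InfTerm) :
    substAt k N (app P Q) = app (substAt k N P) (substAt k N Q) := by
  rw [substAt, PFunctor.M.corec_def]
  exact congrArg PFunctor.M.mk (map_appNode _ _ _)

/-! ### The set of 001-infinitary terms -/

/-- The inductive layer `μX.(𝒱 + λ.X + (X)Y)`. -/
inductive Layer001 (Y : Set InfTerm) : InfTerm → Prop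
  | var (n : ℕ) : Layer001 Y (var n)
  | lam {M : InfTerm} : Layer001 Y M → Layer001 Y (lam M)
  | app {M N : InfTerm} : Layer001 Y M → N ∈ Y → Layer001 Y (app M N)

/-- Membership in `Λ^001 = νY.μX.(𝒱 + λ.X + (X)Y)`: the greatest fixed point is the union of all
sets `Y` contained in their inductive layer. -/
def Is001 (M : InfTerm) : Prop :=
  ∃ Y : Set InfTerm, (∀ N ∈ Y, Layer001 Y N) ∧ M ∈ Y

/-! ### β-reduction -/

/-- One-step β-reduction: the contextual closure of `(λx.M)N ↦ M[N/x]`. -/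
inductive Beta : InfTerm → InfTerm → Prop
  | ax (M N : InfTerm) : Beta (app (lam M) N) (substAt 0 N M)
  | lam {M N : InfTerm} : Beta M N → Beta (lam M) (lam N)
  | appL {M N : InfTerm} (P : InfTerm) : Beta M N → Beta (app M P) (app N P)
  | appR {M N : InfTerm} (P : InfTerm) : Beta M N → Beta (app P M) (app P N)

/-- Finitary β-reduction `→β*`. -/
abbrev BetaStar : InfTerm → InfTerm → Prop := Relation.ReflTransGen Beta

/-- Being in β-normal form. -/
def IsBetaNormal (M : InfTerm) : Prop := ∀ N, ¬ Beta M N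

/-- The inductive layer of infinitary β-reduction; `Y` stands for the guarded ("later") relation
between arguments of applications. -/
inductive LayerBetaInf (Y : InfTerm → InfTerm → Prop) : InfTerm → InfTerm → Prop
  | var {M : InfTerm} {n : ℕ} : BetaStar M (var n) → LayerBetaInf Y M (var n)
  | lam {M P P' : InfTerm} : BetaStar M (lam P) → LayerBetaInf Y P P' →
      LayerBetaInf Y M (lam P')
  | app {M P P' Q Q' : InfTerm} : BetaStar M (app P Q) → LayerBetaInf Y P P' → Y Q Q' →
      LayerBetaInf Y M (app P' Q')

/-- The 001-infinitary reduction `→β^∞`: the greatest fixed point of the inductive layer. -/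
def BetaInf (M N : InfTerm) : Prop :=
  ∃ Y : InfTerm → InfTerm → Prop, (∀ P Q, Y P Q → LayerBetaInf Y P Q) ∧ Y M N

end InfTerm

/-! ## Resource terms -/

/-- The functor `X ↦ 𝒱 + λ.X + ⟨X⟩ Mfin(X)`. -/
inductive ResShape (X : Type) : Type
  | var (n : ℕ)
  | lam (s : X)
  | app (s : X) (t : Multiset X)

/-- Functorial action of `ResShape`. -/
def ResShape.map {X Y : Type} (g : X → Y) : ResShape X → ResShape Y
  | .var n => .var n
  | .lam s => .lam (g s)
  | .app s t => .app (g s) (t.map g)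

instance instFunctorResShape : Functor ResShape where
  map := ResShape.map

/-- Shapes of resource nodes, with the arguments of an application listed in some order. -/
inductive ResLabel : Type
  | var (n : ℕ)
  | lam
  | app (k : ℕ)

/-- The polynomial functor of which `ResShape` is a quotient. -/
def resSig : PFunctor.{0, 0} where
  A := ResLabel
  B := fun a => match a with
    | .var _ => Empty
    | .lam => Unit
    | .app k => Option (Fin k)

/-- Forgetting the order of the arguments. -/
def resAbs {X : Type} : resSig X → ResShape X
  | ⟨.var n, _⟩ => .var n
  | ⟨.lam, f⟩ => .lam (f ())
  | ⟨.app k, f⟩ => .app (f none) (List.ofFn fun i : Fin k => f (some i) : List X)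

/-- Choosing an order of the arguments. -/
noncomputable def resRepr {X : Type} : ResShape X → resSig X
  | .var n => ⟨ResLabel.var n, fun e : Empty => e.elim⟩
  | .lam s => ⟨ResLabel.lam, fun _ : Unit => s⟩
  | .app s t => ⟨ResLabel.app t.toList.length,
      fun o : Option (Fin t.toList.length) => match o with
        | none => s
        | some i => t.toList.get i⟩

noncomputable instance instQPFResShape : QPF ResShape where
  P := resSig
  abs := resAbs
  repr := resRepr
  abs_repr := by
    intro X x
    cases x with
    | var n => rfl
    | lam s => rfl
    | app s t =>
      change ResShape.app s ((List.ofFn fun i => t.toList.get i : List X) : Multiset X) = _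
      rw [List.ofFn_get, Multiset.coe_toList]
  abs_map := by
    rintro X Y g ⟨a, f⟩
    cases a with
    | var n => rfl
    | lam => rfl
    | app k =>
      change ResShape.app _ _ = ResShape.app _ _
      congr 1
      rw [Multiset.map_coe, List.map_ofFn]
      rfl

/-- Resource terms: the initial algebra of `X ↦ 𝒱 + λ.X + ⟨X⟩ Mfin(X)`. Variables are de Bruijn
indices, as above. Resource monomials are the elements of `Multiset ResTerm`. -/
abbrev ResTerm : Type := QPF.Fix ResShape

noncomputable instance instDecidableEqResTerm : DecidableEq ResTerm := Classical.decEq _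

namespace ResTerm

/-- The variable with index `n`. -/
noncomputable def var (n : ℕ) : ResTerm := QPF.Fix.mk (ResShape.var n)

/-- The abstraction `λ.s`. -/
noncomputable def lam (s : ResTerm) : ResTerm := QPF.Fix.mk (ResShape.lam s)

/-- The application `⟨s⟩t` of a resource term to a monomial. -/
noncomputable def app (s : ResTerm) (t : Multiset ResTerm) : ResTerm :=
  QPF.Fix.mk (ResShape.app s t)

/-- Structural induction on resource terms. -/
theorem induct {p : ResTerm → Prop} (hvar : ∀ n, p (var n)) (hlam : ∀ s, p s → p (lam s))
    (happ : ∀ s t, p s → (∀ u ∈ t, p u) → p (app s t)) (s : ResTerm) : p s := by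
  refine QPF.Fix.ind p ?_ s
  rintro x ⟨y, rfl⟩
  cases y with
  | var n => exact hvar n
  | lam s => exact hlam _ s.2
  | app s t =>
    refine happ _ _ s.2 ?_
    intro u hu
    obtain ⟨v, -, rfl⟩ := Multiset.mem_map.1 hu
    exact v.2

theorem mk_inj {x y : ResShape ResTerm}
    (h : (QPF.Fix.mk x : ResTerm) = QPF.Fix.mk y) : x = y := by
  have h' := congrArg (QPF.Fix.dest (F := ResShape)) h
  rwa [QPF.Fix.dest_mk, QPF.Fix.dest_mk] at h'

theorem var_inj {m n : ℕ} : var m = var n ↔ m = n :=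
  ⟨fun h => ResShape.var.inj (mk_inj h), fun h => h ▸ rfl⟩

theorem lam_inj {s s' : ResTerm} : lam s = lam s' ↔ s = s' :=
  ⟨fun h => ResShape.lam.inj (mk_inj h), fun h => h ▸ rfl⟩

theorem app_inj {s s' : ResTerm} {t t' : Multiset ResTerm} :
    app s t = app s' t' ↔ s = s' ∧ t = t' :=
  ⟨fun h => ResShape.app.inj (mk_inj h), fun h => h.1 ▸ h.2 ▸ rfl⟩

theorem var_ne_lam (n : ℕ) (s : ResTerm) : var n ≠ lam s := fun h => nomatch mk_inj h

theorem var_ne_app (n : ℕ) (s : ResTerm) (t : Multiset ResTerm) : var n ≠ app s t :=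
  fun h => nomatch mk_inj h

theorem lam_ne_app (s' s : ResTerm) (t : Multiset ResTerm) : lam s' ≠ app s t :=
  fun h => nomatch mk_inj h

/-- The recursion that defines `rename`. -/
noncomputable def renameAux : ResTerm → (ℕ → ℕ) → ResTerm :=
  QPF.Fix.rec (F := ResShape) fun x => match x with
    | .var n => fun ρ => var (ρ n)
    | .lam f => fun ρ => lam (f (upRen ρ))
    | .app f g => fun ρ => app (f ρ) (g.map fun h => h ρ)

/-- Renaming of free variables. -/
noncomputable def rename (ρ : ℕ → ℕ) (s : ResTerm) : ResTerm := renameAux s ρ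

theorem rename_var (ρ : ℕ → ℕ) (n : ℕ) : rename ρ (var n) = var (ρ n) := by
  rw [rename, renameAux, var, QPF.Fix.rec_eq]
  rfl

theorem rename_lam (ρ : ℕ → ℕ) (s : ResTerm) : rename ρ (lam s) = lam (rename (upRen ρ) s) := by
  rw [rename, renameAux, lam, QPF.Fix.rec_eq]
  rfl

theorem rename_app (ρ : ℕ → ℕ) (s : ResTerm) (t : Multiset ResTerm) :
    rename ρ (app s t) = app (rename ρ s) (t.map (rename ρ)) := by
  rw [rename, renameAux, app, QPF.Fix.rec_eq]
  change app _ ((t.map _).map _) = _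
  rw [Multiset.map_map]
  rfl

/-! ### Resource substitution -/

mutual

/-- `SubstTerm k s t u`: the resource term `u` is obtained from `s` by a bijective replacement of
the free occurrences of the variable of index `k` by the elements of the monomial `t`, each being
used exactly once (so the number of occurrences has to be the cardinality of `t`). Indices above
`k` are lowered, because the binder of that variable disappears. -/
inductive SubstTerm : ℕ → ResTerm → Multiset ResTerm → ResTerm → Prop
  | hit (k : ℕ) (t : ResTerm) : SubstTerm k (var k) {t} (rename (fun i => i + k) t)
  | lt {k n : ℕ} : n < k → SubstTerm k (var n) 0 (var n)
  | gt {k n : ℕ} : k < n → SubstTerm k (var n) 0 (var (n - 1))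
  | lam {k : ℕ} {s u : ResTerm} {t : Multiset ResTerm} :
      SubstTerm (k + 1) s t u → SubstTerm k (lam s) t (lam u)
  | app {k : ℕ} {s u : ResTerm} {m v t₁ t₂ : Multiset ResTerm} :
      SubstTerm k s t₁ u → SubstBag k m t₂ v → SubstTerm k (app s m) (t₁ + t₂) (app u v)

/-- The same for monomials in place of terms. -/
inductive SubstBag : ℕ → Multiset ResTerm → Multiset ResTerm → Multiset ResTerm → Prop
  | nil (k : ℕ) : SubstBag k 0 0 0
  | cons {k : ℕ} {s u : ResTerm} {m v t₁ t₂ : Multiset ResTerm} :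
      SubstTerm k s t₁ u → SubstBag k m t₂ v → SubstBag k (s ::ₘ m) (t₁ + t₂) (u ::ₘ v)

end

theorem finite_substBag (k : ℕ) (c : ℕ) : ∀ m : Multiset ResTerm, Multiset.card m = c →
    (∀ s ∈ m, ∀ t, {u | SubstTerm k s t u}.Finite) → ∀ t, {v | SubstBag k m t v}.Finite := by
  induction c with
  | zero =>
    intro m hm _ t
    refine (Set.finite_singleton (0 : Multiset ResTerm)).subset ?_
    intro v hv
    have hv' : SubstBag k m t v := hv
    cases hv' with
    | nil => rfl
    | cons h1 h2 => simp at hm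
  | succ c ih =>
    intro m hm hfin t
    have key : (⋃ s ∈ m.toFinset, ⋃ p ∈ (Multiset.antidiagonal t).toFinset,
        Set.image2 (fun u v => u ::ₘ v) {u | SubstTerm k s p.1 u}
          {v | SubstBag k (m.erase s) p.2 v}).Finite := by
      refine Set.Finite.biUnion (Finset.finite_toSet _) fun s hs => ?_
      have hs' : s ∈ m := Multiset.mem_toFinset.1 hs
      refine Set.Finite.biUnion (Finset.finite_toSet _) fun p _ => ?_
      refine Set.Finite.image2 _ (hfin s hs' p.1) (ih (m.erase s) ?_ ?_ p.2)
      · rw [Multiset.card_erase_of_mem hs', hm]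
        rfl
      · exact fun s' h' => hfin s' (Multiset.mem_of_mem_erase h')
    refine key.subset ?_
    intro v hv
    have hv' : SubstBag k m t v := hv
    cases hv' with
    | nil => simp at hm
    | @cons _ s u m v t₁ t₂ h1 h2 =>
      refine Set.mem_biUnion (x := s) (by simp) ?_
      refine Set.mem_biUnion (x := (t₁, t₂)) (by simp) ?_
      refine ⟨u, h1, v, ?_, rfl⟩
      simpa using h2

theorem finite_substTerm (s : ResTerm) :
    ∀ (k : ℕ) (t : Multiset ResTerm), {u | SubstTerm k s t u}.Finite := by
  induction s using induct with
  | hvar n =>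
    intro k t
    refine (((Set.finite_singleton (var (n - 1))).insert (var n)).union
      ((Finset.finite_toSet t.toFinset).image (rename fun i => i + k))).subset ?_
    intro u hu
    have hu' : SubstTerm k (var n) t u := hu
    generalize hx : var n = x at hu'
    cases hu' with
    | hit _ t => exact Or.inr ⟨t, by simp, rfl⟩
    | lt h => exact Or.inl (Or.inl rfl)
    | gt h => exact Or.inl (Or.inr (by rw [var_inj.1 hx]; exact Set.mem_singleton _))
    | lam h => exact absurd hx (var_ne_lam _ _)
    | app h1 h2 => exact absurd hx (var_ne_app _ _ _)
  | hlam s ih =>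
    intro k t
    refine ((ih (k + 1) t).image lam).subset ?_
    intro u hu
    have hu' : SubstTerm k (lam s) t u := hu
    generalize hx : lam s = x at hu'
    cases hu' with
    | hit t => exact absurd hx.symm (var_ne_lam _ _)
    | lt h => exact absurd hx.symm (var_ne_lam _ _)
    | gt h => exact absurd hx.symm (var_ne_lam _ _)
    | @lam _ s' u _ h =>
      obtain rfl := lam_inj.1 hx
      exact ⟨u, h, rfl⟩
    | app h1 h2 => exact absurd hx (lam_ne_app _ _ _)
  | happ s m ihs ihm =>
    intro k t
    have key : (⋃ p ∈ (Multiset.antidiagonal t).toFinset,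
        Set.image2 app {u | SubstTerm k s p.1 u} {v | SubstBag k m p.2 v}).Finite :=
      Set.Finite.biUnion (Finset.finite_toSet _) fun p _ =>
        Set.Finite.image2 _ (ihs k p.1)
          (finite_substBag k _ m rfl (fun s' h' t' => ihm s' h' k t') p.2)
    refine key.subset ?_
    intro u hu
    have hu' : SubstTerm k (app s m) t u := hu
    generalize hx : app s m = x at hu'
    cases hu' with
    | hit t => exact absurd hx.symm (var_ne_app _ _ _)
    | lt h => exact absurd hx.symm (var_ne_app _ _ _)
    | gt h => exact absurd hx.symm (var_ne_app _ _ _)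
    | lam h => exact absurd hx.symm (lam_ne_app _ _ _)
    | @app _ s' u m' v t₁ t₂ h1 h2 =>
      obtain ⟨rfl, rfl⟩ := app_inj.1 hx
      refine Set.mem_biUnion (x := (t₁, t₂)) (by simp) ?_
      exact ⟨u, h1, v, h2, rfl⟩

/-- The resource substitution `s⟨t/x⟩`, a finite sum (that is, a finite set) of resource terms,
where `x` is the variable of index `0`. -/
noncomputable def rsubst (s : ResTerm) (t : Multiset ResTerm) : Finset ResTerm :=
  (finite_substTerm s 0 t).toFinset

/-! ### Resource reduction

Finite sums with Boolean coefficients are finite sets; the empty set is the sum `0`. -/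

mutual

/-- Simple resource reduction `↦r` of a resource term to a finite sum. -/
inductive Red : ResTerm → Finset ResTerm → Prop
  | ax (s : ResTerm) (t : Multiset ResTerm) : Red (app (lam s) t) (rsubst s t)
  | lam {s : ResTerm} {S : Finset ResTerm} : Red s S → Red (lam s) (S.image lam)
  | appL {s : ResTerm} {S : Finset ResTerm} (t : Multiset ResTerm) :
      Red s S → Red (app s t) (S.image fun s' => app s' t)
  | appR (s : ResTerm) {t : Multiset ResTerm} {T : Finset (Multiset ResTerm)} :
      RedBag t T → Red (app s t) (T.image fun t' => app s t')

/-- Simple resource reduction `↦r` of a resource monomial to a finite sum of monomials. -/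
inductive RedBag : Multiset ResTerm → Finset (Multiset ResTerm) → Prop
  | bang {s : ResTerm} {S : Finset ResTerm} (t : Multiset ResTerm) :
      Red s S → RedBag (s ::ₘ t) (S.image fun s' => s' ::ₘ t)

end

/-- Resource reduction `→r` of finite sums: from `s₀ ↦r T₀` and `sᵢ ↦r? Tᵢ` for `1 ≤ i ≤ n` infer
`s₀ + ⋯ + sₙ →r T₀ + ⋯ + Tₙ`. -/
inductive RedSum : Finset ResTerm → Finset ResTerm → Prop
  | mk {n : ℕ} (s : Fin (n + 1) → ResTerm) (T : Fin (n + 1) → Finset ResTerm)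
      (h₀ : Red (s 0) (T 0)) (h : ∀ i, i ≠ 0 → Red (s i) (T i) ∨ T i = {s i}) :
      RedSum (Finset.univ.image s) (Finset.univ.biUnion T)

/-- `T` is the normal form `nf_r(s)` of the resource term `s`. -/
def IsNormalFormOf (T : Finset ResTerm) (s : ResTerm) : Prop :=
  Relation.ReflTransGen RedSum {s} T ∧ ∀ T', ¬ RedSum T T'

/-- The `d`-positive resource terms. -/
inductive IsPositive : ℕ → ResTerm → Prop
  | zero (s : ResTerm) : IsPositive 0 s
  | var (d n : ℕ) : IsPositive (d + 1) (var n)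
  | lam {d : ℕ} {s : ResTerm} : IsPositive (d + 1) s → IsPositive (d + 1) (lam s)
  | app {d : ℕ} {s : ResTerm} {t : Multiset ResTerm} : IsPositive (d + 1) s → t ≠ 0 →
      (∀ u ∈ t, IsPositive d u) → IsPositive (d + 1) (app s t)

/-! ### Taylor expansion -/

/-- The relation `s ⋉ M` of Taylor approximation. -/
inductive Approx : ResTerm → InfTerm → Prop
  | var (n : ℕ) : Approx (var n) (InfTerm.var n)
  | lam {s : ResTerm} {M : InfTerm} : Approx s M → Approx (lam s) (InfTerm.lam M)
  | app {s : ResTerm} {t : Multiset ResTerm} {M N : InfTerm} : Approx s M →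
      (∀ u ∈ t, Approx u N) → Approx (app s t) (InfTerm.app M N)

end ResTerm

/-- The Taylor expansion of a term, the set of its approximants. -/
def InfTerm.taylor (M : InfTerm) : Set ResTerm := {s | ResTerm.Approx s M}

-- Resource terms are finite and use every argument exactly once, so both directions reduce to
-- following one summand at a time. `Step s u` says that `u` is one summand of a one-step reduct of
-- `s`. With Boolean coefficients nothing cancels, so a normal term reached by steps survives in a
-- normal form of `s` (`exists_isNormalFormOf`), and every term of the normal form is reached by
-- steps (`exists_steps_of_redSum`). Confluence plays no role.
--
-- From (1) to (2): a 001-term has a `d`-positive approximant `t` for each `d`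
-- (`exists_isPositive_approx`), and approximants of a β-normal term are normal. Since `t` is
-- finite, it sees only a finite part of the infinitary reduction, and can be pulled back along it
-- to an approximant `s` of `M` with `s` stepping to `t` (`exists_steps_of_layer`). Steps decrease
-- size, hence reduction from `s` can be completed without losing `t`.
--
-- From (2) to (1): the difficulty is that the approximants for different `d` are unrelated and
-- reduced in arbitrary order. Standardisation removes it. `Good d s` is reachability of a
-- `d`-positive term by head reduction, then head reduction in the arguments; it holds for normal
-- positive terms and is closed under backward steps (`Good.of_step`), because a substitution lemma
-- lets an internal step be postponed after a head step. Weak head reduction of an approximant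
-- follows that of `M`, which is deterministic, so all approximants of `M` follow the same path.
-- Iterating weak head normalisation corecursively gives the normal form; a finite derivation of
-- `Good 1` shows that each spine is finite, and the higher degrees pass to the arguments.

namespace InfTerm

-- Constructors of infinitary terms: injectivity and disjointness

theorem var_inj {m n : ℕ} (h : var m = var n) : m = n := by
  have h' := congrArg (caseNode id (fun _ => 0) fun _ _ => 0) (PFunctor.M.mk_inj h)
  exact h'

theorem lam_inj {P Q : InfTerm} (h : lam P = lam Q) : P = Q := by
  have h' := congrArg (caseNode (fun _ => P) id fun _ _ => P) (PFunctor.M.mk_inj h)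
  exact h'

theorem app_inj {P Q P' Q' : InfTerm} (h : app P Q = app P' Q') : P = P' ∧ Q = Q' := by
  have h₁ := congrArg (caseNode (fun _ => P) id fun x _ => x) (PFunctor.M.mk_inj h)
  have h₂ := congrArg (caseNode (fun _ => P) id fun _ y => y) (PFunctor.M.mk_inj h)
  exact ⟨h₁, h₂⟩

theorem var_ne_lam (n : ℕ) (P : InfTerm) : var n ≠ lam P :=
  fun h => InfLabel.noConfusion (congrArg Sigma.fst (PFunctor.M.mk_inj h))

theorem var_ne_app (n : ℕ) (P Q : InfTerm) : var n ≠ app P Q :=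
  fun h => InfLabel.noConfusion (congrArg Sigma.fst (PFunctor.M.mk_inj h))

theorem lam_ne_app (M P Q : InfTerm) : lam M ≠ app P Q :=
  fun h => InfLabel.noConfusion (congrArg Sigma.fst (PFunctor.M.mk_inj h))

end InfTerm

/-- The renaming that adds `j` to all indices from `i` on. -/
def shiftFrom (i j n : ℕ) : ℕ := if n < i then n else n + j

theorem upRen_shiftFrom (i j : ℕ) : upRen (shiftFrom i j) = shiftFrom (i + 1) j := by
  funext n
  cases n with
  | zero => simp [upRen, shiftFrom]
  | succ n => simp only [upRen, shiftFrom]; split_ifs <;> omega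

theorem shiftFrom_zero (j : ℕ) : shiftFrom 0 j = fun n => n + j := by
  funext n
  simp [shiftFrom]

theorem upRen_comp (ρ σ : ℕ → ℕ) : upRen ρ ∘ upRen σ = upRen (ρ ∘ σ) := by
  funext n
  cases n <;> rfl

-- Resource terms: renaming, substitution and steps

namespace ResTerm

theorem rename_rename (s : ResTerm) :
    ∀ ρ σ : ℕ → ℕ, rename ρ (rename σ s) = rename (ρ ∘ σ) s := by
  induction s using induct with
  | hvar n => intro ρ σ; simp only [rename_var, Function.comp]
  | hlam s ih => intro ρ σ; simp only [rename_lam, ih, upRen_comp]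
  | happ s t ihs iht =>
    intro ρ σ
    simp only [rename_app, ihs, Multiset.map_map]
    congr 1
    exact Multiset.map_congr rfl fun u hu => iht u hu ρ σ

/-! ### Inversion of resource substitution -/

theorem SubstTerm.var_inv {k n : ℕ} {t : Multiset ResTerm} {u : ResTerm}
    (h : SubstTerm k (var n) t u) :
    (n = k ∧ ∃ a, t = {a} ∧ u = rename (fun i => i + k) a) ∨ (n < k ∧ t = 0 ∧ u = var n) ∨
      (k < n ∧ t = 0 ∧ u = var (n - 1)) := by
  generalize hx : var n = x at h
  cases h with
  | hit _ a => exact Or.inl ⟨var_inj.1 hx, a, rfl, rfl⟩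
  | lt h => obtain rfl := var_inj.1 hx; exact Or.inr (Or.inl ⟨h, rfl, rfl⟩)
  | gt h => obtain rfl := var_inj.1 hx; exact Or.inr (Or.inr ⟨h, rfl, rfl⟩)
  | lam _ => exact absurd hx (var_ne_lam _ _)
  | app _ _ => exact absurd hx (var_ne_app _ _ _)

theorem SubstTerm.lam_inv {k : ℕ} {s u : ResTerm} {t : Multiset ResTerm}
    (h : SubstTerm k (ResTerm.lam s) t u) : ∃ u', u = ResTerm.lam u' ∧ SubstTerm (k + 1) s t u' := by
  generalize hx : ResTerm.lam s = x at h
  cases h with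
  | hit _ a => exact absurd hx.symm (var_ne_lam _ _)
  | lt h => exact absurd hx.symm (var_ne_lam _ _)
  | gt h => exact absurd hx.symm (var_ne_lam _ _)
  | lam h => obtain rfl := lam_inj.1 hx; exact ⟨_, rfl, h⟩
  | app _ _ => exact absurd hx (lam_ne_app _ _ _)

theorem SubstTerm.app_inv {k : ℕ} {s u : ResTerm} {m t : Multiset ResTerm}
    (h : SubstTerm k (ResTerm.app s m) t u) :
    ∃ u' v t₁ t₂, u = ResTerm.app u' v ∧ t = t₁ + t₂ ∧
      SubstTerm k s t₁ u' ∧ SubstBag k m t₂ v := by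
  generalize hx : ResTerm.app s m = x at h
  cases h with
  | hit _ a => exact absurd hx.symm (var_ne_app _ _ _)
  | lt h => exact absurd hx.symm (var_ne_app _ _ _)
  | gt h => exact absurd hx.symm (var_ne_app _ _ _)
  | lam h => exact absurd hx.symm (lam_ne_app _ _ _)
  | app h₁ h₂ => obtain ⟨rfl, rfl⟩ := app_inj.1 hx; exact ⟨_, _, _, _, rfl, rfl, h₁, h₂⟩

theorem SubstBag.zero_inv {k : ℕ} {t v : Multiset ResTerm} (h : SubstBag k 0 t v) :
    t = 0 ∧ v = 0 := by
  generalize hx : (0 : Multiset ResTerm) = x at h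
  cases h with
  | nil => exact ⟨rfl, rfl⟩
  | cons _ _ => exact absurd hx (Multiset.zero_ne_cons)

/-- The last rule of the derivation may have peeled off an element other than `a`. Then `a` lies in
the remaining monomial, which has smaller cardinality, and the two elements are exchanged. -/
theorem SubstBag.cons_inv_aux (c : ℕ) : ∀ {k : ℕ} {a : ResTerm} {m t v : Multiset ResTerm},
    Multiset.card m = c → SubstBag k (a ::ₘ m) t v → ∃ u v' t₁ t₂, v = u ::ₘ v' ∧ t = t₁ + t₂ ∧
      SubstTerm k a t₁ u ∧ SubstBag k m t₂ v' := by
  induction c with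
  | zero =>
    intro k a m t v hm h
    obtain rfl := Multiset.card_eq_zero.1 hm
    generalize hx : a ::ₘ (0 : Multiset ResTerm) = x at h
    cases h with
    | nil => exact absurd hx (Multiset.cons_ne_zero)
    | cons h₁ h₂ =>
      rcases Multiset.cons_eq_cons.1 hx with ⟨rfl, rfl⟩ | ⟨_, cs, h, _⟩
      · exact ⟨_, _, _, _, rfl, rfl, h₁, h₂⟩
      · exact absurd h Multiset.zero_ne_cons
  | succ c ih =>
    intro k a m t v hm h
    generalize hx : a ::ₘ m = x at h
    cases h with
    | nil => exact absurd hx (Multiset.cons_ne_zero)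
    | cons h₁ h₂ =>
      rcases Multiset.cons_eq_cons.1 hx with ⟨rfl, rfl⟩ | ⟨_, cs, rfl, rfl⟩
      · exact ⟨_, _, _, _, rfl, rfl, h₁, h₂⟩
      · obtain ⟨u, v', t₁, t₂, rfl, rfl, h₃, h₄⟩ := ih (by simpa using hm) h₂
        exact ⟨_, _, _, _, Multiset.cons_swap _ _ _, add_left_comm _ _ _, h₃, .cons h₁ h₄⟩

theorem SubstBag.cons_inv {k : ℕ} {a : ResTerm} {m t v : Multiset ResTerm}
    (h : SubstBag k (a ::ₘ m) t v) : ∃ u v' t₁ t₂, v = u ::ₘ v' ∧ t = t₁ + t₂ ∧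
      SubstTerm k a t₁ u ∧ SubstBag k m t₂ v' :=
  SubstBag.cons_inv_aux _ rfl h

theorem SubstBag.add {k : ℕ} {m' t' v' : Multiset ResTerm} (h' : SubstBag k m' t' v')
    (m : Multiset ResTerm) :
    ∀ {t v}, SubstBag k m t v → SubstBag k (m + m') (t + t') (v + v') := by
  induction m using Multiset.induction with
  | empty =>
    intro t v h
    obtain ⟨rfl, rfl⟩ := h.zero_inv
    simpa using h'
  | cons a m ih =>
    intro t v h
    obtain ⟨u, v₁, t₁, t₂, rfl, rfl, h₁, h₂⟩ := h.cons_inv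
    rw [Multiset.cons_add, Multiset.cons_add, add_assoc]
    exact .cons h₁ (ih h₂)

/-! ### Substitution and renaming -/

/-- The image of `ρ` avoids `j`, so there is nothing to replace and only the indices above `j` are
lowered; `σ` is the result of this lowering. -/
theorem substTerm_rename_of_forall_ne (s : ResTerm) : ∀ (j : ℕ) (ρ σ : ℕ → ℕ),
    (∀ n, (ρ n < j ∧ σ n = ρ n) ∨ (j < ρ n ∧ σ n = ρ n - 1)) →
      SubstTerm j (rename ρ s) 0 (rename σ s) := by
  induction s using induct with
  | hvar n =>
    intro j ρ σ h
    rw [rename_var, rename_var]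
    rcases h n with ⟨h₁, h₂⟩ | ⟨h₁, h₂⟩
    · rw [h₂]; exact .lt h₁
    · rw [h₂]; exact .gt h₁
  | hlam s ih =>
    intro j ρ σ h
    rw [rename_lam, rename_lam]
    refine .lam (ih _ _ _ fun n => ?_)
    cases n with
    | zero => exact Or.inl ⟨Nat.succ_pos _, rfl⟩
    | succ n => simp only [upRen]; have := h n; omega
  | happ s t ihs iht =>
    intro j ρ σ h
    rw [rename_app, rename_app, ← add_zero (0 : Multiset ResTerm)]
    refine .app (ihs _ _ _ h) ?_
    induction t using Multiset.induction with
    | empty => exact .nil _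
    | cons a m ih =>
      rw [Multiset.map_cons, Multiset.map_cons, ← add_zero (0 : Multiset ResTerm)]
      exact .cons (iht a (by simp) _ _ _ h) (ih fun u hu => iht u (by simp [hu]))

theorem substBag_rename_inv {k j i : ℕ} (m : Multiset ResTerm)
    (hm : ∀ s ∈ m, ∀ {b : Multiset ResTerm} {u : ResTerm},
      SubstTerm (k + j + i) (rename (shiftFrom i j) s) b u →
        ∃ w, SubstTerm (k + i) s b w ∧ u = rename (shiftFrom i j) w) :
    ∀ {b v : Multiset ResTerm}, SubstBag (k + j + i) (m.map (rename (shiftFrom i j))) b v →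
        ∃ w, SubstBag (k + i) m b w ∧ v = w.map (rename (shiftFrom i j)) := by
  induction m using Multiset.induction with
  | empty =>
    intro b v h
    rw [Multiset.map_zero] at h
    obtain ⟨rfl, rfl⟩ := h.zero_inv
    exact ⟨0, .nil _, rfl⟩
  | cons a m ih =>
    intro b v h
    rw [Multiset.map_cons] at h
    obtain ⟨u, v', t₁, t₂, rfl, rfl, h₁, h₂⟩ := h.cons_inv
    obtain ⟨w, hw, rfl⟩ := hm a (by simp) h₁
    obtain ⟨w', hw', rfl⟩ := ih (fun s hs => hm s (by simp [hs])) h₂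
    exact ⟨w ::ₘ w', .cons hw hw', (Multiset.map_cons _ _ _).symm⟩

/-- The variable being replaced lies at or above the threshold of the shift, so replacement commutes
with the shift. The number `i` counts the binders crossed inside `s`. -/
theorem substTerm_rename_inv (k j : ℕ) (s : ResTerm) :
    ∀ (i : ℕ) {b : Multiset ResTerm} {u : ResTerm},
      SubstTerm (k + j + i) (rename (shiftFrom i j) s) b u →
        ∃ w, SubstTerm (k + i) s b w ∧ u = rename (shiftFrom i j) w := by
  induction s using induct with
  | hvar n =>
    intro i b u h
    rw [rename_var] at h
    rcases h.var_inv with ⟨h₁, a, rfl, rfl⟩ | ⟨h₁, rfl, rfl⟩ | ⟨h₁, rfl, rfl⟩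
    · have hn : n = k + i := by simp only [shiftFrom] at h₁; split_ifs at h₁ <;> omega
      subst hn
      refine ⟨_, .hit _ a, ?_⟩
      rw [rename_rename]
      congr 1
      funext x
      simp only [shiftFrom, Function.comp]
      split_ifs <;> omega
    · have hn : n < k + i := by simp only [shiftFrom] at h₁; split_ifs at h₁ <;> omega
      exact ⟨_, .lt hn, (rename_var _ _).symm⟩
    · have hn : k + i < n := by simp only [shiftFrom] at h₁; split_ifs at h₁ <;> omega
      refine ⟨_, .gt hn, ?_⟩
      rw [rename_var]
      congr 1
      simp only [shiftFrom]
      split_ifs <;> omega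
  | hlam s ih =>
    intro i b u h
    rw [rename_lam, upRen_shiftFrom] at h
    obtain ⟨u', rfl, h'⟩ := h.lam_inv
    obtain ⟨w, hw, rfl⟩ := ih (i + 1) h'
    exact ⟨lam w, .lam hw, by rw [rename_lam, upRen_shiftFrom]⟩
  | happ s t ihs iht =>
    intro i b u h
    rw [rename_app] at h
    obtain ⟨u', v, t₁, t₂, rfl, rfl, h₁, h₂⟩ := h.app_inv
    obtain ⟨w, hw, rfl⟩ := ihs i h₁
    obtain ⟨w', hw', rfl⟩ := substBag_rename_inv t (fun s hs => iht s hs i) h₂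
    exact ⟨app w w', .app hw hw', (rename_app _ _ _).symm⟩

/-- The three thresholds reflect three depths: `b` lives above the `k` binders, `u` below them, and
`s` has in addition the index `k` that the substitution removes. -/
theorem SubstTerm.rename_shiftFrom (c j : ℕ) {k : ℕ} {s u : ResTerm} {b : Multiset ResTerm}
    (h : SubstTerm k s b u) :
    SubstTerm k (rename (shiftFrom (c + k + 1) j) s) (b.map (rename (shiftFrom c j)))
      (rename (shiftFrom (c + k) j) u) := by
  refine SubstTerm.rec
    (motive_1 := fun k s b u _ =>
      SubstTerm k (rename (shiftFrom (c + k + 1) j) s) (b.map (rename (shiftFrom c j)))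
        (rename (shiftFrom (c + k) j) u))
    (motive_2 := fun k m b v _ =>
      SubstBag k (m.map (rename (shiftFrom (c + k + 1) j))) (b.map (rename (shiftFrom c j)))
        (v.map (rename (shiftFrom (c + k) j)))) ?_ ?_ ?_ ?_ ?_ ?_ ?_ h
  · intro k t
    have h₁ : shiftFrom (c + k + 1) j k = k := if_pos (by omega)
    have h₂ : rename (shiftFrom (c + k) j) (rename (fun i => i + k) t) =
        rename (fun i => i + k) (rename (shiftFrom c j) t) := by
      rw [rename_rename, rename_rename]
      congr 1
      funext x
      simp only [shiftFrom, Function.comp]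
      split_ifs <;> omega
    rw [rename_var, h₁, h₂, Multiset.map_singleton]
    exact .hit _ _
  · intro k n hn
    have h₁ : shiftFrom (c + k + 1) j n = n := if_pos (by omega)
    have h₂ : shiftFrom (c + k) j n = n := if_pos (by omega)
    rw [rename_var, rename_var, h₁, h₂]
    exact .lt hn
  · intro k n hn
    have h₁ : k < shiftFrom (c + k + 1) j n := by simp only [shiftFrom]; split_ifs <;> omega
    have h₂ : shiftFrom (c + k) j (n - 1) = shiftFrom (c + k + 1) j n - 1 := by
      simp only [shiftFrom]; split_ifs <;> omega
    rw [rename_var, rename_var, h₂]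
    exact .gt h₁
  · intro k s u t _ ih
    rw [rename_lam, rename_lam, upRen_shiftFrom, upRen_shiftFrom]
    exact .lam ih
  · intro k s u m v t₁ t₂ _ _ ih₁ ih₂
    rw [rename_app, rename_app, Multiset.map_add]
    exact .app ih₁ ih₂
  · intro k
    exact .nil _
  · intro k s u m v t₁ t₂ _ _ ih₁ ih₂
    rw [Multiset.map_cons, Multiset.map_cons, Multiset.map_add]
    exact .cons ih₁ ih₂

/-- The substitution lemma: a substitution into a contractum comes from a substitution into the
redex. -/
theorem SubstTerm.substTerm (k : ℕ) {j : ℕ} {s p : ResTerm} {m : Multiset ResTerm}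
    (h : SubstTerm j s m p) : ∀ {b : Multiset ResTerm} {u : ResTerm}, SubstTerm (k + j) p b u →
      ∃ c e v w, b = c + e ∧ SubstTerm (k + j + 1) s c v ∧ SubstBag k m e w ∧
        SubstTerm j v w u := by
  refine SubstTerm.rec
    (motive_1 := fun j s m p _ => ∀ {b : Multiset ResTerm} {u : ResTerm}, SubstTerm (k + j) p b u →
      ∃ c e v w, b = c + e ∧ SubstTerm (k + j + 1) s c v ∧ SubstBag k m e w ∧
        SubstTerm j v w u)
    (motive_2 := fun j s m p _ => ∀ {b u : Multiset ResTerm}, SubstBag (k + j) p b u →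
      ∃ c e v w, b = c + e ∧ SubstBag (k + j + 1) s c v ∧ SubstBag k m e w ∧
        SubstBag j v w u) ?_ ?_ ?_ ?_ ?_ ?_ ?_ h
  · intro j t b u h
    rw [← shiftFrom_zero] at h
    obtain ⟨w, hw, rfl⟩ := substTerm_rename_inv k j t 0 h
    -- The contractum is a copy of an element of the inner monomial, so all of `b` goes into that
    -- element and none into the variable.
    refine ⟨0, b, var j, {w}, (zero_add b).symm, .lt (by omega), ?_, ?_⟩
    · have := SubstBag.cons hw (.nil _)
      simpa using this
    · rw [shiftFrom_zero]; exact .hit _ _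
  · intro j n hn b u h
    rcases h.var_inv with ⟨h₁, a, rfl, rfl⟩ | ⟨h₁, rfl, rfl⟩ | ⟨h₁, rfl, rfl⟩
    · omega
    · exact ⟨0, 0, var n, 0, rfl, .lt (by omega), .nil _, .lt hn⟩
    · omega
  · intro j n hn b u h
    rcases h.var_inv with ⟨h₁, a, rfl, rfl⟩ | ⟨h₁, rfl, rfl⟩ | ⟨h₁, rfl, rfl⟩
    · obtain rfl : n = k + j + 1 := by omega
      refine ⟨{a}, 0, _, 0, rfl, .hit _ a, .nil _, ?_⟩
      -- The inserted copy of `a` is shifted past `j`; the remaining substitution at `j` with the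
      -- empty monomial lowers its indices by one.
      refine substTerm_rename_of_forall_ne a j _ _ fun n => Or.inr ?_
      omega
    · exact ⟨0, 0, var n, 0, rfl, .lt (by omega), .nil _, .gt hn⟩
    · exact ⟨0, 0, var (n - 1), 0, rfl, .gt (by omega), .nil _, .gt (by omega)⟩
  · intro j s p m _ ih b u h
    obtain ⟨u', rfl, h'⟩ := h.lam_inv
    obtain ⟨c, e, v, w, rfl, h₁, h₂, h₃⟩ := ih h'
    exact ⟨c, e, _, w, rfl, .lam h₁, h₂, .lam h₃⟩
  · intro j s u m v t₁ t₂ _ _ ih₁ ih₂ b x h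
    obtain ⟨u', v', t₁, t₂, rfl, rfl, h₁, h₂⟩ := h.app_inv
    obtain ⟨c, e, _, w, rfl, h₃, h₄, h₅⟩ := ih₁ h₁
    obtain ⟨c', e', _, w', rfl, h₃', h₄', h₅'⟩ := ih₂ h₂
    exact ⟨c + c', e + e', _, w + w', add_add_add_comm _ _ _ _, .app h₃ h₃', h₄'.add _ h₄,
      .app h₅ h₅'⟩
  · intro j b u h
    obtain ⟨rfl, rfl⟩ := h.zero_inv
    exact ⟨0, 0, 0, 0, rfl, .nil _, .nil _, .nil _⟩
  · intro j s u m v t₁ t₂ _ _ ih₁ ih₂ b x h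
    obtain ⟨u', v', t₁, t₂, rfl, rfl, h₁, h₂⟩ := h.cons_inv
    obtain ⟨c, e, _, w, rfl, h₃, h₄, h₅⟩ := ih₁ h₁
    obtain ⟨c', e', _, w', rfl, h₃', h₄', h₅'⟩ := ih₂ h₂
    exact ⟨c + c', e + e', _, w + w', add_add_add_comm _ _ _ _, .cons h₃ h₃', h₄'.add _ h₄,
      .cons h₅ h₅'⟩

/-! ### Reduction of a resource term to one summand of its reduct -/

/-- `Step s u`: the term `u` is a summand of a one-step reduct of `s`. -/
inductive Step : ResTerm → ResTerm → Prop
  | ax {s u : ResTerm} {t : Multiset ResTerm} : SubstTerm 0 s t u → Step (app (lam s) t) u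
  | lam {s u : ResTerm} : Step s u → Step (lam s) (lam u)
  | appL {s u : ResTerm} (t : Multiset ResTerm) : Step s u → Step (app s t) (app u t)
  | appR (s : ResTerm) {a u : ResTerm} (t : Multiset ResTerm) : Step a u →
      Step (app s (a ::ₘ t)) (app s (u ::ₘ t))

theorem mem_rsubst {s u : ResTerm} {t : Multiset ResTerm} :
    u ∈ rsubst s t ↔ SubstTerm 0 s t u := by
  simp [rsubst]

theorem Red.step {s : ResTerm} {S : Finset ResTerm} (h : Red s S) : ∀ u ∈ S, Step s u := by
  -- `Step` has no counterpart on monomials, so these are put in argument position under an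
  -- arbitrary head.
  refine Red.rec (motive_1 := fun s S _ => ∀ u ∈ S, Step s u)
    (motive_2 := fun t T _ => ∀ v ∈ T, ∀ s, Step (app s t) (app s v)) ?_ ?_ ?_ ?_ ?_ h
  · intro s t u hu
    exact .ax (mem_rsubst.1 hu)
  · intro s S _ ih u hu
    obtain ⟨u, hu', rfl⟩ := Finset.mem_image.1 hu
    exact .lam (ih u hu')
  · intro s S t _ ih u hu
    obtain ⟨u, hu', rfl⟩ := Finset.mem_image.1 hu
    exact .appL t (ih u hu')
  · intro s t T _ ih u hu
    obtain ⟨u, hu', rfl⟩ := Finset.mem_image.1 hu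
    exact ih u hu' s
  · intro a S t _ ih u hu s
    obtain ⟨u, hu', rfl⟩ := Finset.mem_image.1 hu
    exact .appR s t (ih u hu')

theorem Step.exists_red {s u : ResTerm} (h : Step s u) : ∃ S, Red s S ∧ u ∈ S := by
  induction h with
  | ax h => exact ⟨_, .ax _ _, mem_rsubst.2 h⟩
  | lam _ ih =>
    obtain ⟨S, h, hu⟩ := ih
    exact ⟨_, .lam h, Finset.mem_image_of_mem _ hu⟩
  | appL t _ ih =>
    obtain ⟨S, h, hu⟩ := ih
    exact ⟨_, .appL t h, Finset.mem_image_of_mem (fun s' => app s' t) hu⟩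
  | appR s t _ ih =>
    obtain ⟨S, h, hu⟩ := ih
    exact ⟨_, .appR s (.bang t h), Finset.mem_image_of_mem (app s)
      (Finset.mem_image_of_mem (fun s' => s' ::ₘ t) hu)⟩

theorem Step.to_var {n : ℕ} {s : ResTerm} (h : Step s (var n)) :
    ∃ p t, s = ResTerm.app (ResTerm.lam p) t ∧ SubstTerm 0 p t (var n) := by
  generalize hx : ResTerm.var n = x at h
  cases h with
  | ax h => exact ⟨_, _, rfl, h⟩
  | lam _ => exact absurd hx (var_ne_lam _ _)
  | appL _ _ => exact absurd hx (var_ne_app _ _ _)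
  | appR _ _ _ => exact absurd hx (var_ne_app _ _ _)

theorem Step.to_lam {s u : ResTerm} (h : Step s (ResTerm.lam u)) :
    (∃ p t, s = ResTerm.app (ResTerm.lam p) t ∧ SubstTerm 0 p t (ResTerm.lam u)) ∨
      ∃ s', s = ResTerm.lam s' ∧ Step s' u := by
  generalize hx : ResTerm.lam u = x at h
  cases h with
  | ax h => exact Or.inl ⟨_, _, rfl, h⟩
  | lam h => obtain rfl := lam_inj.1 hx; exact Or.inr ⟨_, rfl, h⟩
  | appL _ _ => exact absurd hx (lam_ne_app _ _ _)
  | appR _ _ _ => exact absurd hx (lam_ne_app _ _ _)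

theorem Step.to_app {s u : ResTerm} {t : Multiset ResTerm} (h : Step s (ResTerm.app u t)) :
    (∃ p m, s = ResTerm.app (ResTerm.lam p) m ∧ SubstTerm 0 p m (ResTerm.app u t)) ∨
      (∃ s', s = ResTerm.app s' t ∧ Step s' u) ∨
      ∃ a a' t', s = ResTerm.app u (a ::ₘ t') ∧ t = a' ::ₘ t' ∧ Step a a' := by
  generalize hx : ResTerm.app u t = x at h
  cases h with
  | ax h => exact Or.inl ⟨_, _, rfl, h⟩
  | lam _ => exact absurd hx.symm (lam_ne_app _ _ _)
  | appL _ h => obtain ⟨rfl, rfl⟩ := app_inj.1 hx; exact Or.inr (Or.inl ⟨_, rfl, h⟩)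
  | appR _ _ h => obtain ⟨rfl, rfl⟩ := app_inj.1 hx; exact Or.inr (Or.inr ⟨_, _, _, rfl, rfl, h⟩)

theorem Step.rename_shiftFrom (j : ℕ) {s u : ResTerm} (h : Step s u) : ∀ c : ℕ,
    Step (rename (shiftFrom c j) s) (rename (shiftFrom c j) u) := by
  induction h with
  | ax h =>
    intro c
    rw [rename_app, rename_lam, upRen_shiftFrom]
    exact .ax (h.rename_shiftFrom c j)
  | lam _ ih => intro c; rw [rename_lam, rename_lam, upRen_shiftFrom]; exact .lam (ih _)
  | appL t _ ih => intro c; rw [rename_app, rename_app]; exact .appL _ (ih c)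
  | appR s t _ ih =>
    intro c
    rw [rename_app, rename_app, Multiset.map_cons, Multiset.map_cons]
    exact .appR _ _ (ih c)

/-- A reduction before a substitution can be postponed after it. -/
theorem Step.substTerm {p p' : ResTerm} (h : Step p p') : ∀ {k : ℕ} {b : Multiset ResTerm}
    {u' : ResTerm}, SubstTerm k p' b u' → ∃ u, SubstTerm k p b u ∧ Step u u' := by
  induction h with
  | ax h =>
    intro k b u' h'
    obtain ⟨c, e, v, w, rfl, h₁, h₂, h₃⟩ := h.substTerm k h'
    exact ⟨_, .app (.lam h₁) h₂, .ax h₃⟩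
  | lam _ ih =>
    intro k b u' h'
    obtain ⟨u', rfl, h₀⟩ := h'.lam_inv
    obtain ⟨u, h₁, h₂⟩ := ih h₀
    exact ⟨_, .lam h₁, .lam h₂⟩
  | appL t _ ih =>
    intro k b u' h'
    obtain ⟨u', v, t₁, t₂, rfl, rfl, h₁, h₂⟩ := h'.app_inv
    obtain ⟨u, h₃, h₄⟩ := ih h₁
    exact ⟨_, .app h₃ h₂, .appL _ h₄⟩
  | appR s t _ ih =>
    intro k b u' h'
    obtain ⟨u', v, t₁, t₂, rfl, rfl, h₁, h₂⟩ := h'.app_inv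
    obtain ⟨u, v', t₂, t₃, rfl, rfl, h₃, h₄⟩ := h₂.cons_inv
    obtain ⟨u, h₅, h₆⟩ := ih h₃
    exact ⟨_, .app h₁ (.cons h₅ h₄), .appR _ _ h₆⟩

theorem eq_cons_of_add_eq_cons {α : Type*} {t₁ t₂ c : Multiset α} {a : α}
    (h : t₁ + t₂ = a ::ₘ c) :
    (∃ c', t₁ = a ::ₘ c' ∧ c = c' + t₂) ∨ ∃ c', t₂ = a ::ₘ c' ∧ c = t₁ + c' := by
  have ha : a ∈ t₁ + t₂ := h ▸ Multiset.mem_cons_self a c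
  rcases Multiset.mem_add.1 ha with h' | h'
  · obtain ⟨c', rfl⟩ := Multiset.exists_cons_of_mem h'
    rw [Multiset.cons_add, Multiset.cons_inj_right] at h
    exact Or.inl ⟨c', rfl, h.symm⟩
  · obtain ⟨c', rfl⟩ := Multiset.exists_cons_of_mem h'
    rw [Multiset.add_cons, Multiset.cons_inj_right] at h
    exact Or.inr ⟨c', rfl, h.symm⟩

/-- A reduction in a substituted monomial can be postponed after the substitution. -/
theorem SubstTerm.step_cons {a a' : ResTerm} (ha : Step a a') {k : ℕ} {p u' : ResTerm}
    {b : Multiset ResTerm} (h : SubstTerm k p b u') : ∀ {c : Multiset ResTerm}, b = a' ::ₘ c →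
      ∃ u, SubstTerm k p (a ::ₘ c) u ∧ Step u u' := by
  refine SubstTerm.rec
    (motive_1 := fun k p b u' _ => ∀ {c : Multiset ResTerm}, b = a' ::ₘ c →
      ∃ u, SubstTerm k p (a ::ₘ c) u ∧ Step u u')
    -- By linearity `a'` is used exactly once, so putting `a` back affects a single element of the
    -- resulting monomial, and a single step repairs it.
    (motive_2 := fun k m b v' _ => ∀ {c : Multiset ResTerm}, b = a' ::ₘ c →
      ∃ x x' v, SubstBag k m (a ::ₘ c) (x ::ₘ v) ∧ v' = x' ::ₘ v ∧ Step x x')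
    ?_ ?_ ?_ ?_ ?_ ?_ ?_ h
  · intro k t c hc
    obtain ⟨rfl, rfl⟩ := Multiset.singleton_eq_cons_iff c |>.1 hc
    refine ⟨_, .hit k a, ?_⟩
    rw [← shiftFrom_zero]
    exact ha.rename_shiftFrom k 0
  · intro k n _ c hc
    exact absurd hc Multiset.zero_ne_cons
  · intro k n _ c hc
    exact absurd hc Multiset.zero_ne_cons
  · intro k s u t _ ih c hc
    obtain ⟨u, h₁, h₂⟩ := ih hc
    exact ⟨_, .lam h₁, .lam h₂⟩
  · intro k s u m v t₁ t₂ h₁ h₂ ih₁ ih₂ c hc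
    rcases eq_cons_of_add_eq_cons hc with ⟨c', rfl, rfl⟩ | ⟨c', rfl, rfl⟩
    · obtain ⟨u, h₃, h₄⟩ := ih₁ rfl
      refine ⟨ResTerm.app u v, ?_, .appL _ h₄⟩
      rw [← Multiset.cons_add]
      exact .app h₃ h₂
    · obtain ⟨x, x', v, h₃, rfl, h₄⟩ := ih₂ rfl
      refine ⟨ResTerm.app u (x ::ₘ v), ?_, .appR _ _ h₄⟩
      rw [← Multiset.add_cons]
      exact .app h₁ h₃
  · intro k c hc
    exact absurd hc Multiset.zero_ne_cons
  · intro k s u m v t₁ t₂ h₁ h₂ ih₁ ih₂ c hc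
    rcases eq_cons_of_add_eq_cons hc with ⟨c', rfl, rfl⟩ | ⟨c', rfl, rfl⟩
    · obtain ⟨u', h₃, h₄⟩ := ih₁ rfl
      refine ⟨u', u, v, ?_, rfl, h₄⟩
      rw [← Multiset.cons_add]
      exact .cons h₃ h₂
    · obtain ⟨x, x', v, h₃, rfl, h₄⟩ := ih₂ rfl
      refine ⟨x, x', u ::ₘ v, ?_, Multiset.cons_swap _ _ _, h₄⟩
      rw [← Multiset.add_cons, Multiset.cons_swap]
      exact .cons h₁ h₃

end ResTerm

namespace ResTerm

/-! ### Weak head reduction and head-first reachability of positive normal forms -/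

/-- Weak head reduction of a resource term to one summand. -/
inductive WHead : ResTerm → ResTerm → Prop
  | ax {s u : ResTerm} {t : Multiset ResTerm} : SubstTerm 0 s t u → WHead (app (lam s) t) u
  | app {s u : ResTerm} (t : Multiset ResTerm) : WHead s u → WHead (app s t) (app u t)

/-- The terms `⟨…⟨x⟩t₁…⟩tₙ`. -/
inductive Neutral : ResTerm → Prop
  | var (n : ℕ) : Neutral (var n)
  | app {s : ResTerm} (t : Multiset ResTerm) : Neutral s → Neutral (app s t)

/-- `Good d s`: head reduction of `s`, and then of the arguments up to depth `d`, reaches a term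
that is `d`-positive and normal up to depth `d`. -/
inductive Good : ℕ → ResTerm → Prop
  | zero (s : ResTerm) : Good 0 s
  | var (d n : ℕ) : Good (d + 1) (var n)
  | lam {d : ℕ} {s : ResTerm} : Good (d + 1) s → Good (d + 1) (lam s)
  | app {d : ℕ} {s : ResTerm} {t : Multiset ResTerm} : Neutral s → Good (d + 1) s → t ≠ 0 →
      (∀ u ∈ t, Good d u) → Good (d + 1) (app s t)
  | head {d : ℕ} {s u : ResTerm} : WHead s u → Good (d + 1) u → Good (d + 1) s

/-- A step before a head step is itself the head step or lies inside the redex or an argument. In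
the latter case it commutes with the head step by `Step.substTerm` and `SubstTerm.step_cons`;
linearity ensures that exactly one step remains afterwards. -/
theorem Step.whead_postpone {s' s'' : ResTerm} (h' : WHead s' s'') : ∀ {s : ResTerm}, Step s s' →
    WHead s s' ∨ ∃ u, WHead s u ∧ Step u s'' := by
  induction h' with
  | ax hp =>
    intro s h
    rcases h.to_app with ⟨p, m, rfl, h₁⟩ | ⟨f, rfl, h₁⟩ | ⟨a, a', t', rfl, rfl, h₁⟩
    · exact Or.inl (.ax h₁)
    · rcases h₁.to_lam with ⟨p, m, rfl, h₂⟩ | ⟨p, rfl, h₂⟩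
      · exact Or.inl (.app _ (.ax h₂))
      · obtain ⟨u, h₃, h₄⟩ := h₂.substTerm hp
        exact Or.inr ⟨u, .ax h₃, h₄⟩
    · obtain ⟨u, h₂, h₃⟩ := hp.step_cons h₁ rfl
      exact Or.inr ⟨u, .ax h₂, h₃⟩
  | app t hw ih =>
    intro s h
    rcases h.to_app with ⟨p, m, rfl, h₁⟩ | ⟨f, rfl, h₁⟩ | ⟨a, a', t', rfl, rfl, h₁⟩
    · exact Or.inl (.ax h₁)
    · rcases ih h₁ with h₂ | ⟨u, h₂, h₃⟩
      · exact Or.inl (.app _ h₂)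
      · exact Or.inr ⟨_, .app _ h₂, .appL _ h₃⟩
    · exact Or.inr ⟨_, .app _ hw, .appR _ _ h₁⟩

theorem Neutral.step {s' : ResTerm} (h' : Neutral s') : ∀ {s : ResTerm}, Step s s' →
    WHead s s' ∨ Neutral s := by
  induction h' with
  | var n =>
    intro s h
    obtain ⟨p, t, rfl, h₁⟩ := h.to_var
    exact Or.inl (.ax h₁)
  | app t hn ih =>
    intro s h
    rcases h.to_app with ⟨p, m, rfl, h₁⟩ | ⟨f, rfl, h₁⟩ | ⟨a, a', t', rfl, rfl, h₁⟩
    · exact Or.inl (.ax h₁)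
    · rcases ih h₁ with h₂ | h₂
      · exact Or.inl (.app _ h₂)
      · exact Or.inr (.app _ h₂)
    · exact Or.inr (.app _ hn)

/-- Standardisation. A head step is absorbed by the rule `head`; an internal step is moved past each
head step by `whead_postpone` until it falls into the body or an argument, where the induction
hypothesis applies. Below the depth under consideration `Good 0` holds of everything. -/
theorem Good.of_step {d : ℕ} {s' : ResTerm} (h' : Good d s') : ∀ {s : ResTerm}, Step s s' →
    Good d s := by
  induction h' with
  | zero s => intro s _; exact .zero s
  | var d n =>
    intro s h
    obtain ⟨p, t, rfl, h₁⟩ := h.to_var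
    exact .head (.ax h₁) (.var d n)
  | lam hg ih =>
    intro s h
    rcases h.to_lam with ⟨p, m, rfl, h₂⟩ | ⟨p, rfl, h₂⟩
    · exact .head (.ax h₂) (.lam hg)
    · exact .lam (ih h₂)
  | app hn hg ht hu ih ihu =>
    intro s h
    rcases h.to_app with ⟨p, m, rfl, h₁⟩ | ⟨f, rfl, h₁⟩ | ⟨a, a', t', rfl, rfl, h₁⟩
    · exact .head (.ax h₁) (.app hn hg ht hu)
    · rcases hn.step h₁ with h₂ | h₂
      · exact .head (.app _ h₂) (.app hn hg ht hu)
      · exact .app h₂ (ih h₁) ht hu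
    · refine .app hn hg Multiset.cons_ne_zero fun u hm => ?_
      rcases Multiset.mem_cons.1 hm with rfl | hm
      · exact ihu a' (by simp) h₁
      · exact hu u (by simp [hm])
  | head hw hg ih =>
    intro s h
    rcases h.whead_postpone hw with h₁ | ⟨u, h₁, h₂⟩
    · exact .head h₁ (.head hw hg)
    · exact .head h₁ (ih h₂)

theorem Good.of_steps {d : ℕ} {s t : ResTerm} (h : Relation.ReflTransGen Step s t)
    (ht : Good d t) : Good d s := by
  induction h using Relation.ReflTransGen.head_induction_on with
  | refl => exact ht
  | head h _ ih => exact ih.of_step h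

/-! ### Normal resource terms -/

/-- A resource term without reducts. -/
def Normal (s : ResTerm) : Prop := ∀ S, ¬ Red s S

theorem Normal.of_lam {s : ResTerm} (h : Normal (lam s)) : Normal s :=
  fun _ hS => h _ (.lam hS)

theorem Normal.of_app {s : ResTerm} {t : Multiset ResTerm} (h : Normal (app s t)) :
    Normal s ∧ ∀ u ∈ t, Normal u := by
  refine ⟨fun _ hS => h _ (.appL t hS), fun u hu S hS => ?_⟩
  obtain ⟨t', rfl⟩ := Multiset.exists_cons_of_mem hu
  exact h _ (.appR s (.bang t' hS))

theorem Normal.neutral_or_lam (s : ResTerm) : Normal s → Neutral s ∨ ∃ p, s = lam p := by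
  induction s using induct with
  | hvar n => exact fun _ => Or.inl (.var n)
  | hlam s _ => exact fun _ => Or.inr ⟨s, rfl⟩
  | happ s t ih _ =>
    intro h
    rcases ih h.of_app.1 with h' | ⟨p, rfl⟩
    · exact Or.inl (.app t h')
    · exact absurd (Red.ax p t) (h _)

/-- In a normal term every function position is neutral, so the rule `head` is not needed. -/
theorem IsPositive.good {d : ℕ} {s : ResTerm} (h : IsPositive d s) : Normal s → Good d s := by
  induction h with
  | zero s => exact fun _ => .zero s
  | var d n => exact fun _ => .var d n
  | lam _ ih => exact fun hn => .lam (ih hn.of_lam)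
  | @app d s t _ ht _ ih ihu =>
    intro hn
    refine .app ?_ (ih hn.of_app.1) ht fun u hu => ihu u hu (hn.of_app.2 u hu)
    rcases Normal.neutral_or_lam s hn.of_app.1 with h' | ⟨p, rfl⟩
    · exact h'
    · exact absurd (Red.ax p t) (hn _)

/-! ### Reduction of sums and reduction of summands -/

/-- The family in `RedSum` may repeat terms: `s` is listed at position `0` and all of `A` after it,
even if `s` is in `A`. Thus one copy of `s` can be reduced while another is kept. -/
theorem redSum_union_biUnion {s : ResTerm} {S : Finset ResTerm} (h : Red s S)
    (A : Finset ResTerm) (f : ResTerm → Finset ResTerm) (hf : ∀ a ∈ A, Red a (f a) ∨ f a = {a}) :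
    RedSum (insert s A) (S ∪ A.biUnion f) := by
  let e : Fin A.card ≃ A := A.equivFin.symm
  have key := RedSum.mk (n := A.card) (Fin.cons s fun i => (e i : ResTerm))
    (Fin.cons S fun i => f (e i)) h (by
      intro i hi
      obtain ⟨j, rfl⟩ := Fin.exists_succ_eq.2 hi
      simpa using hf (e j) (e j).2)
  convert key using 1
  · ext a
    simp only [Finset.mem_insert, Finset.mem_image, Finset.mem_univ, true_and, Fin.exists_fin_succ,
      Fin.cons_zero, Fin.cons_succ]
    refine or_congr eq_comm ⟨fun ha => ⟨e.symm ⟨a, ha⟩, by simp⟩, ?_⟩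
    rintro ⟨i, rfl⟩
    exact (e i).2
  · ext a
    simp only [Finset.mem_union, Finset.mem_biUnion, Finset.mem_univ, true_and,
      Fin.exists_fin_succ, Fin.cons_zero, Fin.cons_succ]
    refine or_congr Iff.rfl ⟨fun ⟨b, hb, ha⟩ => ⟨e.symm ⟨b, hb⟩, by simpa using ha⟩, ?_⟩
    rintro ⟨i, hi⟩
    exact ⟨_, (e i).2, hi⟩

theorem RedSum.exists_step {S T : Finset ResTerm} (h : RedSum S T) {t : ResTerm} (ht : t ∈ T) :
    ∃ s ∈ S, Relation.ReflTransGen Step s t := by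
  obtain ⟨s, T, h₀, h⟩ := h
  obtain ⟨i, -, hi⟩ := Finset.mem_biUnion.1 ht
  refine ⟨s i, Finset.mem_image_of_mem _ (Finset.mem_univ i), ?_⟩
  by_cases h' : i = 0
  · subst h'
    exact .single (h₀.step t hi)
  · rcases h i h' with h | h
    · exact .single (h.step t hi)
    · rw [h, Finset.mem_singleton] at hi
      rw [hi]

theorem exists_steps_of_redSum {S T : Finset ResTerm} (h : Relation.ReflTransGen RedSum S T) :
    ∀ {t}, t ∈ T → ∃ s ∈ S, Relation.ReflTransGen Step s t := by
  induction h with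
  | refl => exact fun ht => ⟨_, ht, .refl⟩
  | tail _ h ih =>
    intro t ht
    obtain ⟨s, hs, h₁⟩ := h.exists_step ht
    obtain ⟨r, hr, h₂⟩ := ih hs
    exact ⟨r, hr, h₂.trans h₁⟩

theorem normal_of_forall_not_redSum {T : Finset ResTerm} (h : ∀ T', ¬ RedSum T T') {t : ResTerm}
    (ht : t ∈ T) : Normal t := by
  intro S hS
  have := redSum_union_biUnion hS T (fun a => {a}) fun a _ => Or.inr rfl
  rw [Finset.insert_eq_of_mem ht] at this
  exact h _ this

theorem IsNormalFormOf.good {d : ℕ} {s t : ResTerm} {T : Finset ResTerm} (h : IsNormalFormOf T s)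
    (ht : t ∈ T) (hd : IsPositive d t) : Good d s := by
  obtain ⟨s', hs, h'⟩ := exists_steps_of_redSum h.1 ht
  obtain rfl := Finset.mem_singleton.1 hs
  exact .of_steps h' (hd.good (normal_of_forall_not_redSum h.2 ht))

/-! ### Termination -/

/-- The recursion that defines `size`. -/
noncomputable def sizeAux : ResTerm → ℕ :=
  QPF.Fix.rec (F := ResShape) fun x => match x with
    | .var _ => 1
    | .lam n => n + 1
    | .app n t => n + t.sum + 1

/-- The number of nodes of a resource term. -/
noncomputable def size (s : ResTerm) : ℕ := sizeAux s

theorem size_var (n : ℕ) : size (var n) = 1 := by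
  rw [size, sizeAux, var, QPF.Fix.rec_eq]
  rfl

theorem size_lam (s : ResTerm) : size (lam s) = size s + 1 := by
  rw [size, sizeAux, lam, QPF.Fix.rec_eq]
  rfl

theorem size_app (s : ResTerm) (t : Multiset ResTerm) :
    size (app s t) = size s + (t.map size).sum + 1 := by
  rw [size, sizeAux, app, QPF.Fix.rec_eq]
  rfl

theorem size_rename (s : ResTerm) : ∀ ρ, size (rename ρ s) = size s := by
  induction s using induct with
  | hvar n => intro ρ; rw [rename_var, size_var, size_var]
  | hlam s ih => intro ρ; rw [rename_lam, size_lam, size_lam, ih]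
  | happ s t ihs iht =>
    intro ρ
    rw [rename_app, size_app, size_app, ihs, Multiset.map_map]
    congr 3
    exact Multiset.map_congr rfl fun u hu => iht u hu ρ

theorem SubstTerm.size_le {k : ℕ} {s u : ResTerm} {t : Multiset ResTerm}
    (h : SubstTerm k s t u) : size u ≤ size s + (t.map size).sum := by
  refine SubstTerm.rec
    (motive_1 := fun k s t u _ => size u ≤ size s + (t.map size).sum)
    (motive_2 := fun k m t v _ => (v.map size).sum ≤ (m.map size).sum + (t.map size).sum)
    ?_ ?_ ?_ ?_ ?_ ?_ ?_ h
  · intro k t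
    simp [size_rename]
  · intro k n _
    simp
  · intro k n _
    simp [size_var]
  · intro k s u t _ ih
    rw [size_lam, size_lam]
    omega
  · intro k s u m v t₁ t₂ _ _ ih₁ ih₂
    rw [size_app, size_app, Multiset.map_add, Multiset.sum_add]
    omega
  · intro k
    simp
  · intro k s u m v t₁ t₂ _ _ ih₁ ih₂
    simp only [Multiset.map_cons, Multiset.sum_cons, Multiset.map_add, Multiset.sum_add]
    omega

/-- Substitution duplicates nothing, and a contracted redex loses its application and abstraction
nodes. -/
theorem Step.size_lt {s u : ResTerm} (h : Step s u) : size u < size s := by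
  induction h with
  | ax h =>
    have := h.size_le
    rw [size_app, size_lam]
    omega
  | lam _ ih => rw [size_lam, size_lam]; omega
  | appL t _ ih => rw [size_app, size_app]; omega
  | appR s t _ ih =>
    simp only [size_app, Multiset.map_cons, Multiset.sum_cons]
    omega

/-- Here `n` bounds the sizes of the summands that are not yet normal. Reducing all of these in
parallel lowers the bound by one and leaves the normal summands in place. -/
theorem exists_normal_sum (n : ℕ) : ∀ S : Finset ResTerm,
    (∀ s ∈ S, Normal s ∨ size s ≤ n) → ∃ T, Relation.ReflTransGen RedSum S T ∧
      (∀ t ∈ T, Normal t) ∧ ∀ s ∈ S, Normal s → s ∈ T := by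
  induction n with
  | zero =>
    intro S hS
    refine ⟨S, .refl, fun s hs => ?_, fun s hs _ => hs⟩
    rcases hS s hs with h | h
    · exact h
    · intro A hA
      have : ∀ s : ResTerm, 0 < size s := fun s => by
        induction s using induct with
        | hvar n => rw [size_var]; omega
        | hlam s _ => rw [size_lam]; omega
        | happ s t _ _ => rw [size_app]; omega
      exact absurd (this s) (by omega)
  | succ n ih =>
    intro S hS
    classical
    by_cases hn : ∀ s ∈ S, Normal s
    · exact ⟨S, .refl, hn, fun s hs _ => hs⟩
    push Not at hn
    obtain ⟨s, hs, hs'⟩ := hn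
    -- `f a` is a chosen reduct of `a`, or `{a}` if `a` is normal.
    have hf : ∀ a : ResTerm, ∃ A, (Red a A ∨ A = {a}) ∧ (Normal a → A = {a}) ∧
        (¬ Normal a → Red a A) := by
      intro a
      by_cases ha : Normal a
      · exact ⟨{a}, Or.inr rfl, fun _ => rfl, fun h => absurd ha h⟩
      · have ha' := ha
        unfold Normal at ha'
        push Not at ha'
        obtain ⟨A, hA⟩ := ha'
        exact ⟨A, Or.inl hA, fun h => absurd h ha, fun _ => hA⟩
    choose f hf₁ hf₂ hf₃ using hf
    have hstep := redSum_union_biUnion (hf₃ s hs') S f fun a _ => hf₁ a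
    rw [Finset.insert_eq_of_mem hs,
      Finset.union_eq_right.2 (Finset.subset_biUnion_of_mem f hs)] at hstep
    obtain ⟨T, h₁, h₂, h₃⟩ := ih (S.biUnion f) (by
      intro t ht
      obtain ⟨a, ha, ht⟩ := Finset.mem_biUnion.1 ht
      by_cases ha' : Normal a
      · rw [hf₂ a ha', Finset.mem_singleton] at ht
        exact Or.inl (ht ▸ ha')
      · have h₁ := ((hf₃ a ha').step t ht).size_lt
        have h₂ := (hS a ha).resolve_left ha'
        exact Or.inr (by omega))
    refine ⟨T, .head hstep h₁, h₂, fun a ha ha' => h₃ a ?_ ha'⟩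
    exact Finset.mem_biUnion.2 ⟨a, ha, by simp [hf₂ a ha']⟩

theorem exists_redSum_of_steps {s t : ResTerm} (h : Relation.ReflTransGen Step s t) :
    ∃ T, Relation.ReflTransGen RedSum {s} T ∧ t ∈ T := by
  induction h with
  | refl => exact ⟨_, .refl, Finset.mem_singleton_self _⟩
  | tail _ h ih =>
    obtain ⟨T, h₁, h₂⟩ := ih
    obtain ⟨S, h₃, h₄⟩ := h.exists_red
    have := redSum_union_biUnion h₃ T (fun a => {a}) fun a _ => Or.inr rfl
    rw [Finset.insert_eq_of_mem h₂] at this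
    exact ⟨_, h₁.tail this, Finset.mem_union_left _ h₄⟩

theorem exists_isNormalFormOf {s t : ResTerm} (h : Relation.ReflTransGen Step s t)
    (ht : Normal t) : ∃ T, IsNormalFormOf T s ∧ t ∈ T := by
  obtain ⟨S, h₁, h₂⟩ := exists_redSum_of_steps h
  obtain ⟨T, h₃, h₄, h₅⟩ := exists_normal_sum (S.sup size) S
    fun s hs => Or.inr (Finset.le_sup (f := size) hs)
  refine ⟨T, ⟨h₁.trans h₃, ?_⟩, h₅ t h₂ ht⟩
  rintro T' ⟨s, _, h₀, -⟩
  exact h₄ (s 0) (Finset.mem_image_of_mem _ (Finset.mem_univ _)) _ h₀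

end ResTerm

namespace ResTerm

open InfTerm (Beta BetaStar LayerBetaInf Layer001)

/-! ### Inversion of Taylor approximation -/

theorem Approx.var_inv {n : ℕ} {M : InfTerm} (h : Approx (ResTerm.var n) M) :
    M = InfTerm.var n := by
  generalize hx : ResTerm.var n = x at h
  cases h with
  | var n => rw [var_inj.1 hx]
  | lam _ => exact absurd hx (var_ne_lam _ _)
  | app _ _ => exact absurd hx (var_ne_app _ _ _)

theorem Approx.lam_inv {s : ResTerm} {M : InfTerm} (h : Approx (ResTerm.lam s) M) :
    ∃ P, M = InfTerm.lam P ∧ Approx s P := by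
  generalize hx : ResTerm.lam s = x at h
  cases h with
  | var n => exact absurd hx.symm (var_ne_lam _ _)
  | lam h => obtain rfl := lam_inj.1 hx; exact ⟨_, rfl, h⟩
  | app _ _ => exact absurd hx (lam_ne_app _ _ _)

theorem Approx.app_inv {s : ResTerm} {t : Multiset ResTerm} {M : InfTerm}
    (h : Approx (ResTerm.app s t) M) :
    ∃ P Q, M = InfTerm.app P Q ∧ Approx s P ∧ ∀ u ∈ t, Approx u Q := by
  generalize hx : ResTerm.app s t = x at h
  cases h with
  | var n => exact absurd hx.symm (var_ne_app _ _ _)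
  | lam h => exact absurd hx.symm (lam_ne_app _ _ _)
  | app h₁ h₂ => obtain ⟨rfl, rfl⟩ := app_inj.1 hx; exact ⟨_, _, rfl, h₁, h₂⟩

theorem Approx.inv_var {n : ℕ} {s : ResTerm} (h : Approx s (InfTerm.var n)) :
    s = ResTerm.var n := by
  generalize hx : InfTerm.var n = x at h
  cases h with
  | var n => rw [InfTerm.var_inj hx]
  | lam _ => exact absurd hx (InfTerm.var_ne_lam _ _)
  | app _ _ => exact absurd hx (InfTerm.var_ne_app _ _ _)

theorem Approx.inv_lam {s : ResTerm} {P : InfTerm} (h : Approx s (InfTerm.lam P)) :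
    ∃ p, s = ResTerm.lam p ∧ Approx p P := by
  generalize hx : InfTerm.lam P = x at h
  cases h with
  | var n => exact absurd hx.symm (InfTerm.var_ne_lam _ _)
  | lam h => obtain rfl := InfTerm.lam_inj hx; exact ⟨_, rfl, h⟩
  | app _ _ => exact absurd hx (InfTerm.lam_ne_app _ _ _)

theorem Approx.inv_app {s : ResTerm} {P Q : InfTerm} (h : Approx s (InfTerm.app P Q)) :
    ∃ p t, s = ResTerm.app p t ∧ Approx p P ∧ ∀ u ∈ t, Approx u Q := by
  generalize hx : InfTerm.app P Q = x at h
  cases h with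
  | var n => exact absurd hx.symm (InfTerm.var_ne_app _ _ _)
  | lam h => exact absurd hx.symm (InfTerm.lam_ne_app _ _ _)
  | app h₁ h₂ => obtain ⟨rfl, rfl⟩ := InfTerm.app_inj hx; exact ⟨_, _, rfl, h₁, h₂⟩

/-! ### Approximation, renaming and substitution -/

theorem Approx.rename {s : ResTerm} {M : InfTerm} (h : Approx s M) : ∀ ρ : ℕ → ℕ,
    Approx (ResTerm.rename ρ s) (InfTerm.rename ρ M) := by
  induction h with
  | var n => intro ρ; rw [rename_var, InfTerm.rename_var]; exact .var _
  | lam _ ih => intro ρ; rw [rename_lam, InfTerm.rename_lam]; exact .lam (ih _)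
  | app _ _ ih iht =>
    intro ρ
    rw [rename_app, InfTerm.rename_app]
    refine .app (ih ρ) fun u hu => ?_
    obtain ⟨v, hv, rfl⟩ := Multiset.mem_map.1 hu
    exact iht v hv ρ

theorem exists_multiset_map {α β : Type*} {p : α → Prop} {f : α → β} (t : Multiset β)
    (h : ∀ b ∈ t, ∃ a, p a ∧ b = f a) : ∃ m : Multiset α, (∀ a ∈ m, p a) ∧ t = m.map f := by
  induction t using Multiset.induction with
  | empty => exact ⟨0, by simp, rfl⟩
  | cons b t ih =>
    obtain ⟨a, ha, rfl⟩ := h b (by simp)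
    obtain ⟨m, hm, rfl⟩ := ih fun c hc => h c (by simp [hc])
    exact ⟨a ::ₘ m, by simpa [ha] using hm, (Multiset.map_cons _ _ _).symm⟩

theorem Approx.rename_inv (u : ResTerm) : ∀ {ρ : ℕ → ℕ} {M : InfTerm},
    Approx u (InfTerm.rename ρ M) → ∃ s, Approx s M ∧ u = ResTerm.rename ρ s := by
  induction u using induct with
  | hvar n =>
    intro ρ M h
    have h' := h.var_inv
    rcases InfTerm.cases_term M with ⟨m, rfl⟩ | ⟨P, rfl⟩ | ⟨P, Q, rfl⟩
    · rw [InfTerm.rename_var] at h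
      exact ⟨_, .var m, by rw [rename_var, h.inv_var]⟩
    · rw [InfTerm.rename_lam] at h'
      exact absurd h'.symm (InfTerm.var_ne_lam _ _)
    · rw [InfTerm.rename_app] at h'
      exact absurd h'.symm (InfTerm.var_ne_app _ _ _)
  | hlam u ih =>
    intro ρ M h
    rcases InfTerm.cases_term M with ⟨m, rfl⟩ | ⟨P, rfl⟩ | ⟨P, Q, rfl⟩
    · rw [InfTerm.rename_var] at h
      exact absurd h.inv_var.symm (var_ne_lam _ _)
    · rw [InfTerm.rename_lam] at h
      obtain ⟨p, hp, h'⟩ := h.inv_lam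
      obtain rfl := lam_inj.1 hp
      obtain ⟨s, hs, rfl⟩ := ih h'
      exact ⟨_, .lam hs, (rename_lam _ _).symm⟩
    · rw [InfTerm.rename_app] at h
      obtain ⟨_, _, hp, _⟩ := h.inv_app
      exact absurd hp (lam_ne_app _ _ _)
  | happ u t ih iht =>
    intro ρ M h
    rcases InfTerm.cases_term M with ⟨m, rfl⟩ | ⟨P, rfl⟩ | ⟨P, Q, rfl⟩
    · rw [InfTerm.rename_var] at h
      exact absurd h.inv_var.symm (var_ne_app _ _ _)
    · rw [InfTerm.rename_lam] at h
      obtain ⟨_, hp, _⟩ := h.inv_lam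
      exact absurd hp.symm (lam_ne_app _ _ _)
    · rw [InfTerm.rename_app] at h
      obtain ⟨_, _, hp, h₁, h₂⟩ := h.inv_app
      obtain ⟨rfl, rfl⟩ := app_inj.1 hp
      obtain ⟨s, hs, rfl⟩ := ih h₁
      obtain ⟨m, hm, rfl⟩ := exists_multiset_map t fun v hv => iht v hv (h₂ v hv)
      exact ⟨_, .app hs hm, (rename_app _ _ _).symm⟩

theorem Approx.substTerm {N : InfTerm} {k : ℕ} {s u : ResTerm} {b : Multiset ResTerm}
    (h : SubstTerm k s b u) : ∀ {M : InfTerm}, Approx s M → (∀ a ∈ b, Approx a N) →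
      Approx u (InfTerm.substAt k N M) := by
  refine SubstTerm.rec
    (motive_1 := fun k s b u _ => ∀ {M : InfTerm}, Approx s M → (∀ a ∈ b, Approx a N) →
      Approx u (InfTerm.substAt k N M))
    (motive_2 := fun k m b v _ => ∀ {M : InfTerm}, (∀ a ∈ m, Approx a M) →
      (∀ a ∈ b, Approx a N) → ∀ a ∈ v, Approx a (InfTerm.substAt k N M))
    ?_ ?_ ?_ ?_ ?_ ?_ ?_ h
  · intro k t M hM hN
    obtain rfl := hM.var_inv
    rw [InfTerm.substAt_var_eq]
    exact (hN t (by simp)).rename _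
  · intro k n hn M hM _
    obtain rfl := hM.var_inv
    rw [InfTerm.substAt_var_lt N hn]
    exact .var n
  · intro k n hn M hM _
    obtain rfl := hM.var_inv
    rw [InfTerm.substAt_var_gt N hn]
    exact .var _
  · intro k s u t _ ih M hM hN
    obtain ⟨P, rfl, hP⟩ := hM.lam_inv
    rw [InfTerm.substAt_lam]
    exact .lam (ih hP hN)
  · intro k s u m v t₁ t₂ _ _ ih₁ ih₂ M hM hN
    obtain ⟨P, Q, rfl, hP, hQ⟩ := hM.app_inv
    rw [InfTerm.substAt_app]
    exact .app (ih₁ hP fun a ha => hN a (Multiset.mem_add.2 (Or.inl ha)))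
      (ih₂ hQ fun a ha => hN a (Multiset.mem_add.2 (Or.inr ha)))
  · intro k M _ _ a ha
    simp at ha
  · intro k s u m v t₁ t₂ _ _ ih₁ ih₂ M hM hN a ha
    rcases Multiset.mem_cons.1 ha with rfl | ha
    · exact ih₁ (hM s (by simp)) fun a ha => hN a (Multiset.mem_add.2 (Or.inl ha))
    · exact ih₂ (fun a ha => hM a (by simp [ha]))
        (fun a ha => hN a (Multiset.mem_add.2 (Or.inr ha))) a ha

theorem exists_substBag {k : ℕ} {p q : ResTerm → Prop} (v : Multiset ResTerm)
    (h : ∀ u ∈ v, ∃ s b, p s ∧ (∀ a ∈ b, q a) ∧ SubstTerm k s b u) :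
    ∃ m b, (∀ s ∈ m, p s) ∧ (∀ a ∈ b, q a) ∧ SubstBag k m b v := by
  induction v using Multiset.induction with
  | empty => exact ⟨0, 0, by simp, by simp, .nil _⟩
  | cons u v ih =>
    obtain ⟨s, b, h₁, h₂, h₃⟩ := h u (by simp)
    obtain ⟨m, b', h₁', h₂', h₃'⟩ := ih fun c hc => h c (by simp [hc])
    refine ⟨s ::ₘ m, b + b', by simpa [h₁] using h₁', fun a ha => ?_, .cons h₃ h₃'⟩
    exact (Multiset.mem_add.1 ha).elim (h₂ a) (h₂' a)

theorem Approx.substAt_inv {N : InfTerm} (u : ResTerm) : ∀ {k : ℕ} {M : InfTerm},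
    Approx u (InfTerm.substAt k N M) →
      ∃ s b, Approx s M ∧ (∀ a ∈ b, Approx a N) ∧ SubstTerm k s b u := by
  -- Where `M` is the replaced variable, `u` is an approximant of a renamed copy of `N` and can have
  -- any shape. This case is therefore settled before the induction on `u`.
  have hvar : ∀ (u : ResTerm) (k m : ℕ), Approx u (InfTerm.substAt k N (InfTerm.var m)) →
      ∃ s b, Approx s (InfTerm.var m) ∧ (∀ a ∈ b, Approx a N) ∧ SubstTerm k s b u := by
    intro u k m h
    rcases lt_trichotomy m k with hm | rfl | hm
    · rw [InfTerm.substAt_var_lt N hm] at h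
      obtain rfl := h.inv_var
      exact ⟨_, 0, .var m, by simp, .lt hm⟩
    · rw [InfTerm.substAt_var_eq] at h
      obtain ⟨s, hs, rfl⟩ := h.rename_inv
      exact ⟨_, {s}, .var m, by simpa using hs, .hit m s⟩
    · rw [InfTerm.substAt_var_gt N hm] at h
      obtain rfl := h.inv_var
      exact ⟨_, 0, .var m, by simp, .gt hm⟩
  induction u using induct with
  | hvar n =>
    intro k M h
    have h' := h.var_inv
    rcases InfTerm.cases_term M with ⟨m, rfl⟩ | ⟨P, rfl⟩ | ⟨P, Q, rfl⟩
    · exact hvar _ _ _ h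
    · rw [InfTerm.substAt_lam] at h'
      exact absurd h'.symm (InfTerm.var_ne_lam _ _)
    · rw [InfTerm.substAt_app] at h'
      exact absurd h'.symm (InfTerm.var_ne_app _ _ _)
  | hlam u ih =>
    intro k M h
    rcases InfTerm.cases_term M with ⟨m, rfl⟩ | ⟨P, rfl⟩ | ⟨P, Q, rfl⟩
    · exact hvar _ _ _ h
    · rw [InfTerm.substAt_lam] at h
      obtain ⟨p, hp, h'⟩ := h.inv_lam
      obtain rfl := lam_inj.1 hp
      obtain ⟨s, b, hs, hb, h''⟩ := ih h'
      exact ⟨_, b, .lam hs, hb, .lam h''⟩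
    · rw [InfTerm.substAt_app] at h
      obtain ⟨_, _, hp, _⟩ := h.inv_app
      exact absurd hp (lam_ne_app _ _ _)
  | happ u t ih iht =>
    intro k M h
    rcases InfTerm.cases_term M with ⟨m, rfl⟩ | ⟨P, rfl⟩ | ⟨P, Q, rfl⟩
    · exact hvar _ _ _ h
    · rw [InfTerm.substAt_lam] at h
      obtain ⟨_, hp, _⟩ := h.inv_lam
      exact absurd hp.symm (lam_ne_app _ _ _)
    · rw [InfTerm.substAt_app] at h
      obtain ⟨_, _, hp, h₁, h₂⟩ := h.inv_app
      obtain ⟨rfl, rfl⟩ := app_inj.1 hp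
      obtain ⟨s, b, hs, hb, h₃⟩ := ih h₁
      obtain ⟨m, b', hm, hb', h₄⟩ := exists_substBag t fun v hv => iht v hv (h₂ v hv)
      refine ⟨_, b + b', .app hs hm, fun a ha => ?_, .app h₃ h₄⟩
      exact (Multiset.mem_add.1 ha).elim (hb a) (hb' a)

/-! ### Simulation of infinitary reduction -/

theorem steps_lam {s u : ResTerm} (h : Relation.ReflTransGen Step s u) :
    Relation.ReflTransGen Step (lam s) (lam u) :=
  h.lift lam fun _ _ => Step.lam

/-- The elements are reduced one after another; `c` collects those already treated. -/
theorem exists_steps_bag {p : ResTerm → Prop} (s : ResTerm) (t : Multiset ResTerm)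
    (h : ∀ u ∈ t, ∃ a, p a ∧ Relation.ReflTransGen Step a u) :
    ∃ m : Multiset ResTerm, (∀ a ∈ m, p a) ∧
      ∀ c, Relation.ReflTransGen Step (app s (m + c)) (app s (t + c)) := by
  induction t using Multiset.induction with
  | empty => exact ⟨0, by simp, fun _ => .refl⟩
  | cons u t ih =>
    obtain ⟨a, ha, hu⟩ := h u (by simp)
    obtain ⟨m, hm, h'⟩ := ih fun c hc => h c (by simp [hc])
    refine ⟨a ::ₘ m, by simpa [ha] using hm, fun c => ?_⟩
    rw [Multiset.cons_add]
    refine (hu.lift (fun x => app s (x ::ₘ (m + c))) fun _ _ => Step.appR s _).trans ?_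
    simpa only [Multiset.cons_add, Multiset.add_cons] using h' (u ::ₘ c)

theorem exists_steps_app {P Q : InfTerm} {p : ResTerm} {t : Multiset ResTerm}
    (hp : ∃ a, Approx a P ∧ Relation.ReflTransGen Step a p)
    (ht : ∀ u ∈ t, ∃ a, Approx a Q ∧ Relation.ReflTransGen Step a u) :
    ∃ s, Approx s (InfTerm.app P Q) ∧ Relation.ReflTransGen Step s (app p t) := by
  obtain ⟨a, ha, h⟩ := hp
  obtain ⟨m, hm, h'⟩ := exists_steps_bag p t ht
  refine ⟨app a m, .app ha hm, (h.lift (fun x => app x m) fun _ _ => Step.appL m).trans ?_⟩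
  simpa using h' 0

/-- A β-step inside an argument is matched by reductions in each element of a monomial, hence by any
number of steps, possibly none. -/
theorem exists_steps_of_beta {M N : InfTerm} (h : Beta M N) : ∀ {t : ResTerm}, Approx t N →
    ∃ s, Approx s M ∧ Relation.ReflTransGen Step s t := by
  induction h with
  | ax M N =>
    intro t ht
    obtain ⟨s, b, hs, hb, h⟩ := ht.substAt_inv
    exact ⟨_, .app (.lam hs) hb, .single (.ax h)⟩
  | lam _ ih =>
    intro t ht
    obtain ⟨p, rfl, hp⟩ := ht.inv_lam
    obtain ⟨s, hs, h⟩ := ih hp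
    exact ⟨_, .lam hs, steps_lam h⟩
  | appL P _ ih =>
    intro t ht
    obtain ⟨p, b, rfl, hp, hb⟩ := ht.inv_app
    exact exists_steps_app (ih hp) fun u hu => ⟨u, hb u hu, .refl⟩
  | appR P _ ih =>
    intro t ht
    obtain ⟨p, b, rfl, hp, hb⟩ := ht.inv_app
    exact exists_steps_app ⟨p, hp, .refl⟩ fun u hu => ih (hb u hu)

theorem exists_steps_of_betaStar {M N : InfTerm} (h : BetaStar M N) : ∀ {t : ResTerm},
    (∃ s, Approx s N ∧ Relation.ReflTransGen Step s t) →
      ∃ s, Approx s M ∧ Relation.ReflTransGen Step s t := by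
  induction h with
  | refl => exact fun h => h
  | tail _ h ih =>
    rintro t ⟨s, hs, h'⟩
    obtain ⟨r, hr, h''⟩ := exists_steps_of_beta h hs
    exact ih ⟨r, hr, h''.trans h'⟩

/-- The induction is on the finite term `t`: the coinductive premise is opened only at the elements
of its monomials, hence finitely often. -/
theorem exists_steps_of_layer {Y : InfTerm → InfTerm → Prop}
    (hY : ∀ P Q, Y P Q → LayerBetaInf Y P Q) (t : ResTerm) : ∀ {M N : InfTerm},
    LayerBetaInf Y M N → Approx t N → ∃ s, Approx s M ∧ Relation.ReflTransGen Step s t := by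
  induction t using induct with
  | hvar n =>
    intro M N h ht
    obtain rfl := ht.var_inv
    generalize hx : InfTerm.var n = x at h
    cases h with
    | var h =>
      obtain rfl := InfTerm.var_inj hx
      exact exists_steps_of_betaStar h ⟨_, .var n, .refl⟩
    | lam _ _ => exact absurd hx (InfTerm.var_ne_lam _ _)
    | app _ _ _ => exact absurd hx (InfTerm.var_ne_app _ _ _)
  | hlam t ih =>
    intro M N h ht
    obtain ⟨P, rfl, hP⟩ := ht.lam_inv
    generalize hx : InfTerm.lam P = x at h
    cases h with
    | var h => exact absurd hx.symm (InfTerm.var_ne_lam _ _)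
    | lam h h' =>
      obtain rfl := InfTerm.lam_inj hx
      obtain ⟨s, hs, hst⟩ := ih h' hP
      exact exists_steps_of_betaStar h ⟨_, .lam hs, steps_lam hst⟩
    | app _ _ _ => exact absurd hx (InfTerm.lam_ne_app _ _ _)
  | happ t b ih ihb =>
    intro M N h ht
    obtain ⟨P, Q, rfl, hP, hQ⟩ := ht.app_inv
    generalize hx : InfTerm.app P Q = x at h
    cases h with
    | var h => exact absurd hx.symm (InfTerm.var_ne_app _ _ _)
    | lam h h' => exact absurd hx.symm (InfTerm.lam_ne_app _ _ _)
    | app h h₁ h₂ =>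
      obtain ⟨rfl, rfl⟩ := InfTerm.app_inj hx
      exact exists_steps_of_betaStar h
        (exists_steps_app (ih h₁ hP) fun u hu => ihb u hu (hY _ _ h₂) (hQ u hu))

theorem Approx.normal (t : ResTerm) : ∀ {N : InfTerm}, Approx t N → N.IsBetaNormal →
    Normal t := by
  have key : ∀ {S : Finset ResTerm}, Red t S → ∀ {N : InfTerm}, Approx t N →
      ∃ N', Beta N N' := by
    intro S h
    refine Red.rec (motive_1 := fun t _ _ => ∀ {N : InfTerm}, Approx t N → ∃ N', Beta N N')
      (motive_2 := fun t _ _ => ∀ {N : InfTerm}, (∀ u ∈ t, Approx u N) → ∃ N', Beta N N')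
      ?_ ?_ ?_ ?_ ?_ h
    · intro s t N hN
      obtain ⟨P, Q, rfl, hP, -⟩ := hN.app_inv
      obtain ⟨P, rfl, -⟩ := hP.lam_inv
      exact ⟨_, .ax P Q⟩
    · intro s S _ ih N hN
      obtain ⟨P, rfl, hP⟩ := hN.lam_inv
      obtain ⟨P', h⟩ := ih hP
      exact ⟨_, .lam h⟩
    · intro s S t _ ih N hN
      obtain ⟨P, Q, rfl, hP, -⟩ := hN.app_inv
      obtain ⟨P', h⟩ := ih hP
      exact ⟨_, .appL Q h⟩
    · intro s t T _ ih N hN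
      obtain ⟨P, Q, rfl, -, hQ⟩ := hN.app_inv
      obtain ⟨Q', h⟩ := ih hQ
      exact ⟨_, .appR P h⟩
    · intro s S t _ ih N hN
      exact ih (hN s (by simp))
  intro N hN hn S hS
  obtain ⟨N', h⟩ := key hS hN
  exact hn N' h

/-- The inner induction follows the inductive layer, the outer one on `d` crosses the guard into
arguments. One copy of each argument makes the monomials non-empty; at degree `0` empty ones
suffice. -/
theorem exists_isPositive_approx {Y : Set InfTerm} (hY : ∀ N ∈ Y, Layer001 Y N) (d : ℕ) :
    ∀ {N : InfTerm}, Layer001 Y N → ∃ t, Approx t N ∧ IsPositive (d + 1) t := by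
  have key : ∀ d : ℕ, (∀ N ∈ Y, ∃ t, Approx t N ∧ IsPositive d t) → ∀ {N : InfTerm},
      Layer001 Y N → ∃ t, Approx t N ∧ IsPositive (d + 1) t := by
    intro d hd N h
    induction h with
    | var n => exact ⟨_, .var n, .var d n⟩
    | lam _ ih =>
      obtain ⟨t, ht, h⟩ := ih
      exact ⟨_, .lam ht, .lam h⟩
    | app _ hN ih =>
      obtain ⟨t, ht, h⟩ := ih
      obtain ⟨u, hu, h'⟩ := hd _ hN
      exact ⟨app t {u}, .app ht (by simpa using hu), .app h (by simp) (by simpa using h')⟩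
  have base : ∀ {N : InfTerm}, Layer001 Y N → ∃ t, Approx t N := by
    intro N h
    induction h with
    | var n => exact ⟨_, .var n⟩
    | lam _ ih => exact ih.imp' lam fun _ => .lam
    | app _ _ ih => exact ih.imp' (app · 0) fun _ h => .app h (by simp)
  induction d with
  | zero => exact key 0 fun N hN => (base (hY N hN)).imp fun t ht => ⟨ht, .zero t⟩
  | succ d ih => exact key (d + 1) fun N hN => ih (hY N hN)

end ResTerm

namespace InfTerm

open ResTerm (Approx Good)

/-! ### Weak head reduction of infinitary terms -/

/-- Weak head reduction of infinitary terms. -/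
inductive WHead : InfTerm → InfTerm → Prop
  | ax (M N : InfTerm) : WHead (app (lam M) N) (substAt 0 N M)
  | app {M N : InfTerm} (P : InfTerm) : WHead M N → WHead (app M P) (app N P)

theorem WHead.beta {M N : InfTerm} (h : WHead M N) : Beta M N := by
  induction h with
  | ax M N => exact .ax M N
  | app P _ ih => exact .appL P ih

theorem not_whead_var {n : ℕ} {N : InfTerm} (h : WHead (var n) N) : False := by
  generalize hx : InfTerm.var n = x at h
  cases h with
  | ax _ _ => exact var_ne_app _ _ _ hx
  | app _ _ => exact var_ne_app _ _ _ hx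

theorem not_whead_lam {M N : InfTerm} (h : WHead (lam M) N) : False := by
  generalize hx : InfTerm.lam M = x at h
  cases h with
  | ax _ _ => exact lam_ne_app _ _ _ hx
  | app _ _ => exact lam_ne_app _ _ _ hx

theorem whead_app_inv {P Q N : InfTerm} (h : WHead (app P Q) N) :
    (∃ P', P = lam P' ∧ N = substAt 0 Q P') ∨ ∃ P', N = app P' Q ∧ WHead P P' := by
  generalize hx : InfTerm.app P Q = x at h
  cases h with
  | ax _ _ => obtain ⟨rfl, rfl⟩ := app_inj hx; exact Or.inl ⟨_, rfl, rfl⟩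
  | app _ h => obtain ⟨rfl, rfl⟩ := app_inj hx; exact Or.inr ⟨_, rfl, h⟩

theorem WHead.unique {M N : InfTerm} (h : WHead M N) : ∀ {N' : InfTerm}, WHead M N' →
    N' = N := by
  induction h with
  | ax M N =>
    intro N' h'
    rcases whead_app_inv h' with ⟨P', h₁, rfl⟩ | ⟨P', rfl, h₁⟩
    · rw [lam_inj h₁]
    · exact (not_whead_lam h₁).elim
  | app P h ih =>
    intro N' h'
    rcases whead_app_inv h' with ⟨P', rfl, rfl⟩ | ⟨P', rfl, h₁⟩
    · exact (not_whead_lam h).elim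
    · rw [ih h₁]

/-- A term without weak head reduct. -/
def IsWHNF (M : InfTerm) : Prop := ∀ N, ¬ WHead M N

theorem Neutral.isWHNF {s : ResTerm} (h : s.Neutral) : ∀ {M : InfTerm}, Approx s M →
    M.IsWHNF ∧ ∀ P, M ≠ lam P := by
  induction h with
  | var n =>
    intro M hM
    obtain rfl := hM.var_inv
    exact ⟨fun _ h => not_whead_var h, var_ne_lam n⟩
  | app t _ ih =>
    intro M hM
    obtain ⟨P, Q, rfl, hP, -⟩ := hM.app_inv
    obtain ⟨h₁, h₂⟩ := ih hP
    refine ⟨fun N h => ?_, fun R h => lam_ne_app _ _ _ h.symm⟩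
    rcases whead_app_inv h with ⟨P', rfl, -⟩ | ⟨P', -, h'⟩
    · exact h₂ _ rfl
    · exact h₁ _ h'

/-- The weak head redex never lies in a monomial, so the one of `s` sits exactly over the one of
`M`. -/
theorem exists_whead_of_approx {s u : ResTerm} (h : s.WHead u) : ∀ {M : InfTerm}, Approx s M →
    ∃ N, WHead M N ∧ Approx u N := by
  induction h with
  | ax h =>
    intro M hM
    obtain ⟨P, Q, rfl, hP, hQ⟩ := hM.app_inv
    obtain ⟨P, rfl, hP'⟩ := hP.lam_inv
    exact ⟨_, .ax P Q, .substTerm h hP' hQ⟩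
  | app t _ ih =>
    intro M hM
    obtain ⟨P, Q, rfl, hP, hQ⟩ := hM.app_inv
    obtain ⟨P', h₁, h₂⟩ := ih hP
    exact ⟨_, .app Q h₁, .app h₂ hQ⟩

/-- The terms that have an approximant of every positivity degree reached by head reduction. -/
def Normalisable (M : InfTerm) : Prop := ∀ d, ∃ s, Approx s M ∧ Good (d + 1) s

/-- As `M` has a weak head redex, the derivation of `Good` ends with the rule `head`; by determinism
its reduct approximates the same `N` for every `d`. -/
theorem Normalisable.whead {M N : InfTerm} (hM : M.Normalisable) (h : WHead M N) :
    N.Normalisable := by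
  intro d
  obtain ⟨s, hs, hg⟩ := hM d
  generalize hd : d + 1 = e at hg
  cases hg with
  | zero => omega
  | var d n =>
    obtain rfl := hs.var_inv
    exact (not_whead_var h).elim
  | lam _ =>
    obtain ⟨P, rfl, -⟩ := hs.lam_inv
    exact (not_whead_lam h).elim
  | app hn _ _ _ => exact ((Neutral.isWHNF (hn.app _) hs).1 _ h).elim
  | head hw hg =>
    obtain ⟨N', h₁, h₂⟩ := exists_whead_of_approx hw hs
    obtain rfl := h.unique h₁
    exact ⟨_, h₂, hd ▸ hg⟩

theorem Normalisable.of_lam {P : InfTerm} (h : (lam P).Normalisable) : P.Normalisable := by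
  intro d
  obtain ⟨s, hs, hg⟩ := h d
  obtain ⟨p, rfl, hp⟩ := hs.inv_lam
  generalize hd : d + 1 = e at hg
  generalize hx : ResTerm.lam p = x at hg
  cases hg with
  | zero => omega
  | var d n => exact absurd hx.symm (ResTerm.var_ne_lam _ _)
  | lam hg => obtain rfl := ResTerm.lam_inj.1 hx; exact ⟨_, hp, hd ▸ hg⟩
  | app _ _ _ _ => exact absurd hx (ResTerm.lam_ne_app _ _ _)
  | head hw _ =>
    subst hx
    obtain ⟨N, h₁, -⟩ := exists_whead_of_approx hw hs
    exact (not_whead_lam h₁).elim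

theorem Normalisable.of_app {P Q : InfTerm} (h : (app P Q).Normalisable)
    (hn : (app P Q).IsWHNF) : P.Normalisable ∧ Q.Normalisable := by
  have key : ∀ d, ∃ (p : ResTerm) (b : Multiset ResTerm), Approx p P ∧ (∀ u ∈ b, Approx u Q) ∧ Good (d + 1) p ∧
      b ≠ 0 ∧ ∀ u ∈ b, Good d u := by
    intro d
    obtain ⟨s, hs, hg⟩ := h d
    obtain ⟨p, b, rfl, hp, hb⟩ := hs.inv_app
    generalize hd : d + 1 = e at hg
    generalize hx : ResTerm.app p b = x at hg
    cases hg with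
    | zero => omega
    | var d n => exact absurd hx.symm (ResTerm.var_ne_app _ _ _)
    | lam hg => exact absurd hx.symm (ResTerm.lam_ne_app _ _ _)
    | app _ h₁ h₂ h₃ =>
      obtain ⟨rfl, rfl⟩ := ResTerm.app_inj.1 hx
      obtain rfl : d = _ := Nat.succ_injective hd
      exact ⟨p, b, hp, hb, h₁, h₂, h₃⟩
    | head hw _ =>
      subst hx
      obtain ⟨N, h₁, -⟩ := exists_whead_of_approx hw hs
      exact (hn N h₁).elim
  refine ⟨fun d => ?_, fun d => ?_⟩
  · obtain ⟨p, b, h₁, -, h₂, -⟩ := key d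
    exact ⟨p, h₁, h₂⟩
  · obtain ⟨p, b, -, h₁, -, h₂, h₃⟩ := key (d + 1)
    obtain ⟨u, hu⟩ := Multiset.exists_mem_of_ne_zero h₂
    exact ⟨u, h₁ u hu, h₃ u hu⟩

/-! ### The infinitary normal form -/

open Classical in
/-- The weak head normal form of a term, if there is one. -/
noncomputable def whnf (M : InfTerm) : InfTerm :=
  if h : ∃ N, Relation.ReflTransGen WHead M N ∧ N.IsWHNF then h.choose else M

theorem whnf_eq {M N : InfTerm} (h : Relation.ReflTransGen WHead M N) (hN : N.IsWHNF) :
    whnf M = N := by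
  have hex : ∃ N, Relation.ReflTransGen WHead M N ∧ N.IsWHNF := ⟨N, h, hN⟩
  rw [whnf, dif_pos hex]
  obtain ⟨h₁, h₂⟩ := hex.choose_spec
  generalize hex.choose = N' at h₁ h₂
  induction h using Relation.ReflTransGen.head_induction_on with
  | refl =>
    rcases h₁.cases_head with rfl | ⟨_, h, _⟩
    · rfl
    · exact (hN _ h).elim
  | head h h' ih =>
    rcases h₁.cases_head with rfl | ⟨_, h'', h₃⟩
    · exact (h₂ _ h).elim
    · obtain rfl := h.unique h''
      exact ih ⟨N, h', hN⟩ h₃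

theorem Normalisable.exists_whnf {M : InfTerm} (hM : M.Normalisable) :
    ∃ N, Relation.ReflTransGen WHead M N ∧ N.IsWHNF := by
  obtain ⟨s, hs, hg⟩ := hM 0
  clear hM
  -- Degree `1` already bounds the head reduction. Its positivity is kept through the generalisation
  -- to exclude the rule `zero`.
  have he : 0 < 0 + 1 := Nat.one_pos
  generalize 0 + 1 = e at hg he
  induction hg generalizing M with
  | zero => omega
  | var d n =>
    obtain rfl := hs.var_inv
    exact ⟨_, .refl, fun _ h => not_whead_var h⟩
  | lam _ _ =>
    obtain ⟨P, rfl, -⟩ := hs.lam_inv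
    exact ⟨_, .refl, fun _ h => not_whead_lam h⟩
  | app hn _ _ _ _ _ => exact ⟨_, .refl, (Neutral.isWHNF (hn.app _) hs).1⟩
  | head hw _ ih =>
    obtain ⟨N, h₁, h₂⟩ := exists_whead_of_approx hw hs
    obtain ⟨N', h₃, h₄⟩ := ih h₂ he
    exact ⟨N', .head h₁ h₃, h₄⟩

/-- The normal form of a term, by corecursive weak head reduction. -/
noncomputable def normalForm (M : InfTerm) : InfTerm :=
  PFunctor.M.corec (fun M => PFunctor.M.dest (whnf M)) M

theorem normalForm_var {M : InfTerm} {n : ℕ} (h : whnf M = var n) : normalForm M = var n := by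
  rw [normalForm, PFunctor.M.corec_def, h]
  exact congrArg PFunctor.M.mk (map_varNode _ n)

theorem normalForm_lam {M P : InfTerm} (h : whnf M = lam P) :
    normalForm M = lam (normalForm P) := by
  rw [normalForm, PFunctor.M.corec_def, h]
  exact congrArg PFunctor.M.mk (map_lamNode _ P)

theorem normalForm_app {M P Q : InfTerm} (h : whnf M = app P Q) :
    normalForm M = app (normalForm P) (normalForm Q) := by
  rw [normalForm, PFunctor.M.corec_def, h]
  exact congrArg PFunctor.M.mk (map_appNode _ P Q)

theorem IsWHNF.whnf_eq {M : InfTerm} (h : M.IsWHNF) : whnf M = M := InfTerm.whnf_eq .refl h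

theorem Normalisable.normalForm_whead {M N : InfTerm} (hM : M.Normalisable) (h : WHead M N) :
    normalForm M = normalForm N := by
  obtain ⟨N', h₁, h₂⟩ := (hM.whead h).exists_whnf
  rw [normalForm, normalForm, PFunctor.M.corec_def, PFunctor.M.corec_def,
    whnf_eq h₁ h₂, whnf_eq (.head h h₁) h₂]

theorem IsWHNF.of_app {P Q : InfTerm} (h : (app P Q).IsWHNF) :
    P.IsWHNF ∧ ∀ R, P ≠ lam R :=
  ⟨fun _ h' => h _ (.app Q h'), fun R h' => h _ (h' ▸ WHead.ax R Q)⟩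

/-- Induction along the head reduction of a normalisable term. -/
theorem Normalisable.spine_induction {p : InfTerm → Prop} (hvar : ∀ n, p (var n))
    (hlam : ∀ P, p P → p (lam P))
    (happ : ∀ P Q, (app P Q).IsWHNF → Q.Normalisable → p P → p (app P Q))
    (hhead : ∀ M N, M.Normalisable → WHead M N → p N → p M) {M : InfTerm}
    (hM : M.Normalisable) : p M := by
  -- The derivation of `Good 1` is finite and traces the head steps and the spine, leaving the
  -- arguments untouched.
  obtain ⟨s, hs, hg⟩ := hM 0
  have he : 0 < 0 + 1 := Nat.one_pos
  generalize 0 + 1 = e at hg he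
  induction hg generalizing M with
  | zero => omega
  | var d n =>
    obtain rfl := hs.var_inv
    exact hvar n
  | lam _ ih =>
    obtain ⟨P, rfl, hP⟩ := hs.lam_inv
    exact hlam P (ih hM.of_lam hP he)
  | app hn _ _ _ ih _ =>
    have hwh := (Neutral.isWHNF (hn.app _) hs).1
    obtain ⟨P, Q, rfl, hP, -⟩ := hs.app_inv
    exact happ P Q hwh (hM.of_app hwh).2 (ih (hM.of_app hwh).1 hP he)
  | head hw _ ih =>
    obtain ⟨N, h₁, h₂⟩ := exists_whead_of_approx hw hs
    exact hhead M N hM h₁ (ih (hM.whead h₁) h₂ he)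

/-- The set of all normal forms of normalisable terms is a post-fixed point: the spine is handled by
induction, and the arguments fall back into the set. -/
theorem Normalisable.is001_normalForm {M : InfTerm} (hM : M.Normalisable) :
    (normalForm M).Is001 := by
  refine ⟨normalForm '' {M | M.Normalisable}, ?_, M, hM, rfl⟩
  rintro _ ⟨M, hM, rfl⟩
  refine Normalisable.spine_induction
    (p := fun M => Layer001 (normalForm '' {M | M.Normalisable}) (normalForm M)) ?_ ?_ ?_ ?_ hM
  · intro n
    rw [normalForm_var (IsWHNF.whnf_eq fun _ h => not_whead_var h)]
    exact .var n
  · intro P ih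
    rw [normalForm_lam (IsWHNF.whnf_eq fun _ h => not_whead_lam h)]
    exact .lam ih
  · intro P Q h hQ ih
    rw [normalForm_app h.whnf_eq]
    exact .app ih ⟨Q, hQ, rfl⟩
  · intro M N hM h ih
    rwa [hM.normalForm_whead h]

theorem LayerBetaInf.head {Y : InfTerm → InfTerm → Prop} {M N R : InfTerm} (h : BetaStar M N)
    (h' : LayerBetaInf Y N R) : LayerBetaInf Y M R := by
  cases h' with
  | var h₁ => exact .var (h.trans h₁)
  | lam h₁ h₂ => exact .lam (h.trans h₁) h₂
  | app h₁ h₂ h₃ => exact .app (h.trans h₁) h₂ h₃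

theorem Normalisable.betaInf_normalForm {M : InfTerm} (hM : M.Normalisable) :
    BetaInf M (normalForm M) := by
  refine ⟨fun M N => M.Normalisable ∧ N = normalForm M, ?_, hM, rfl⟩
  rintro M _ ⟨hM, rfl⟩
  refine Normalisable.spine_induction
    (p := fun M => LayerBetaInf (fun M N => M.Normalisable ∧ N = normalForm M) M (normalForm M))
    ?_ ?_ ?_ ?_ hM
  · intro n
    rw [normalForm_var (IsWHNF.whnf_eq fun _ h => not_whead_var h)]
    exact .var .refl
  · intro P ih
    rw [normalForm_lam (IsWHNF.whnf_eq fun _ h => not_whead_lam h)]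
    exact .lam .refl ih
  · intro P Q h hQ ih
    rw [normalForm_app h.whnf_eq]
    exact .app .refl ih ⟨hQ, rfl⟩
  · intro M N hM h ih
    rw [hM.normalForm_whead h]
    exact .head (.single h.beta) ih

theorem Normalisable.exists_eq_whnf {M : InfTerm} (hM : M.Normalisable) :
    ∃ N, N.Normalisable ∧ N.IsWHNF ∧ normalForm M = normalForm N := by
  obtain ⟨N, h, hN⟩ := hM.exists_whnf
  induction h using Relation.ReflTransGen.head_induction_on with
  | refl => exact ⟨N, hM, hN, rfl⟩
  | head h _ ih =>
    obtain ⟨N', h₁, h₂, h₃⟩ := ih (hM.whead h)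
    exact ⟨N', h₁, h₂, (hM.normalForm_whead h).trans h₃⟩

theorem normalForm_ne_lam {P : InfTerm} (hP : P.IsWHNF) (h : ∀ R, P ≠ lam R) (R : InfTerm) :
    normalForm P ≠ lam R := by
  rcases cases_term P with ⟨n, rfl⟩ | ⟨P, rfl⟩ | ⟨P, Q, rfl⟩
  · rw [normalForm_var hP.whnf_eq]
    exact var_ne_lam n R
  · exact absurd rfl (h P)
  · rw [normalForm_app hP.whnf_eq]
    exact (lam_ne_app _ _ _).symm

/-- A redex would lie at finite depth; induction on its position brings it to the root. There the
function part comes from the function part of a weak head normal application, whose normal form is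
not an abstraction. -/
theorem Normalisable.isBetaNormal_normalForm {M : InfTerm} (hM : M.Normalisable) :
    (normalForm M).IsBetaNormal := by
  have key : ∀ {X X' : InfTerm}, Beta X X' → ∀ {M : InfTerm}, M.Normalisable → M.IsWHNF →
      normalForm M = X → False := by
    intro X X' h
    -- Subterms of a weak head normal form need not be weak head normal; passing to their own weak
    -- head normal forms leaves the normal form unchanged.
    have reduce : ∀ {X : InfTerm}, (∀ {M : InfTerm}, M.Normalisable → M.IsWHNF →
        normalForm M = X → False) → ∀ {M : InfTerm}, M.Normalisable → normalForm M = X →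
          False := by
      intro X ih M hM hX
      obtain ⟨N, h₁, h₂, h₃⟩ := hM.exists_eq_whnf
      exact ih h₁ h₂ (h₃.symm.trans hX)
    induction h with
    | ax P Q =>
      intro M hM hn hX
      rcases cases_term M with ⟨n, rfl⟩ | ⟨R, rfl⟩ | ⟨R, S, rfl⟩
      · exact var_ne_app _ _ _ ((normalForm_var hn.whnf_eq).symm.trans hX)
      · exact lam_ne_app _ _ _ ((normalForm_lam hn.whnf_eq).symm.trans hX)
      · have h₁ := (app_inj ((normalForm_app hn.whnf_eq).symm.trans hX)).1
        obtain ⟨h₂, h₃⟩ := hn.of_app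
        exact normalForm_ne_lam h₂ h₃ _ h₁
    | lam _ ih =>
      intro M hM hn hX
      rcases cases_term M with ⟨n, rfl⟩ | ⟨R, rfl⟩ | ⟨R, S, rfl⟩
      · exact var_ne_lam _ _ ((normalForm_var hn.whnf_eq).symm.trans hX)
      · exact reduce ih hM.of_lam (lam_inj ((normalForm_lam hn.whnf_eq).symm.trans hX))
      · exact lam_ne_app _ _ _ (hX.symm.trans (normalForm_app hn.whnf_eq))
    | appL P _ ih =>
      intro M hM hn hX
      rcases cases_term M with ⟨n, rfl⟩ | ⟨R, rfl⟩ | ⟨R, S, rfl⟩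
      · exact var_ne_app _ _ _ ((normalForm_var hn.whnf_eq).symm.trans hX)
      · exact lam_ne_app _ _ _ ((normalForm_lam hn.whnf_eq).symm.trans hX)
      · exact reduce ih (hM.of_app hn).1 (app_inj ((normalForm_app hn.whnf_eq).symm.trans hX)).1
    | appR P _ ih =>
      intro M hM hn hX
      rcases cases_term M with ⟨n, rfl⟩ | ⟨R, rfl⟩ | ⟨R, S, rfl⟩
      · exact var_ne_app _ _ _ ((normalForm_var hn.whnf_eq).symm.trans hX)
      · exact lam_ne_app _ _ _ ((normalForm_lam hn.whnf_eq).symm.trans hX)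
      · exact reduce ih (hM.of_app hn).2 (app_inj ((normalForm_app hn.whnf_eq).symm.trans hX)).2
  intro X' h
  obtain ⟨N, h₁, h₂, h₃⟩ := hM.exists_eq_whnf
  exact key h h₁ h₂ h₃.symm

end InfTerm

-- The characterisation of normalisable terms

theorem mainTheorem8 (M : InfTerm) (hM : M.Is001) :
    (∃ N : InfTerm, N.Is001 ∧ N.IsBetaNormal ∧ InfTerm.BetaInf M N) ↔
      ∀ d : ℕ, ∃ s ∈ M.taylor, ∃ T : Finset ResTerm,
        ResTerm.IsNormalFormOf T s ∧ ∃ t ∈ T, ResTerm.IsPositive d t := by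
  constructor
  · rintro ⟨N, ⟨Y, hY, hN⟩, hn, Z, hZ, hMN⟩ d
    have hpos : ∃ t, ResTerm.Approx t N ∧ ResTerm.IsPositive d t := by
      cases d with
      | zero =>
        obtain ⟨t, ht, -⟩ := ResTerm.exists_isPositive_approx hY 0 (hY N hN)
        exact ⟨t, ht, .zero t⟩
      | succ d => exact ResTerm.exists_isPositive_approx hY d (hY N hN)
    obtain ⟨t, ht, hd⟩ := hpos
    obtain ⟨s, hs, h⟩ := ResTerm.exists_steps_of_layer hZ t (hZ M N hMN) ht
    obtain ⟨T, h₁, h₂⟩ := ResTerm.exists_isNormalFormOf h (ht.normal t hn)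
    exact ⟨s, hs, T, h₁, t, h₂, hd⟩
  · intro h
    have h' : M.Normalisable := by
      intro d
      -- Degree `0` carries no information, so `Normalisable` is indexed from degree `1`.
      obtain ⟨s, hs, T, hT, t, ht, hd⟩ := h (d + 1)
      exact ⟨s, hs, hT.good ht hd⟩
    exact ⟨_, h'.is001_normalForm, h'.isBetaNormal_normalForm, h'.betaInf_normalForm⟩
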